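/- Let $(\overline M[4\rho],\langle\cdot,\cdot\rangle,J)$ be a complex space form of complex dimension two, that is, a Kähler manifold of real dimension four with constant holomorphic sectional curvature $4\rho$, $\rho\in\mathbb R$. Let $M^2$ be a connected oriented smooth two-dimensional Riemannian manifold and $x:M^2\to\overline M[4\rho]$ a smooth isometric immersion with second fundamental form $B$, whose mean curvature vector $H=\frac12\operatorname{tr}B$ is nowhere zero and parallel for the normal connection; put $b=|H|/2>0$. Let $\alpha:M^2\to[0,\pi]$ be the Kähler angle: $\cos\alpha=\langle J\,dx(e_1),dx(e_2)\rangle$ for positively oriented orthonormal bases $(e_1,e_2)$ of the tangent planes. To such a basis at a point where $\sin\alpha\ne0$ belong the normal vectors $e_3,e_4$ with $J\,dx(e_2)=-\cos\alpha\,dx(e_1)-\sin\alpha\,e_3$ and $J\,dx(e_1)=\cos\alpha\,dx(e_2)+\sin\alpha\,e_4$. Call the basis adapted if $H=-|H|e_3$, and for an adapted basis put $$\phi(w)=\langle e_1,w\rangle+i\langle e_2,w\rangle,\qquad a=-\tfrac14\left(S_{11}-S_{22}-2iS_{12}\right),\qquad S_{jk}=\langle B(e_j,e_k),e_3\rangle+i\langle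 B(e_j,e_k),e_4\rangle .$$ Suppose that $\alpha$ is not constant. Then there are points with $d\alpha\neq0$, and every point $p$ with $d\alpha_p\ne0$ has an open neighbourhood $W$ with smooth real functions $\beta,k$ on $W$, $k$ nowhere zero, such that: 1. $(\alpha,\beta)$ is a smooth coordinate system on $W$. 2. At every point of $W$ an adapted basis exists, and for every adapted basis $a+b\neq0$ and $$\phi=\frac{1}{2k(a+b)}\left(k\,d\alpha-i\,d\beta\right).$$ 3. For all isothermal coordinates $(u,v)$ on an open set $W'\subset M^2$ such that $\phi=\lambda(du+i\,dv)$ for a complex-valued function $\lambda$ (wherever adapted bases exist), one has on $W\cap W'$ $$\alpha_uk_u+\alpha_vk_v+(\alpha_{uu}+\alpha_{vv})k=0,\qquad \beta_u=k\alpha_v,\qquad \beta_v=-k\alpha_u .$$ -/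

import Mathlib

open scoped Manifold ContDiff InnerProductSpace
open Bundle

noncomputable section

namespace KaehlerPMC

/-- The model space `ℝ²` of surfaces. -/
abbrev E2 : Type := EuclideanSpace ℝ (Fin 2)

/-- The model space `ℝ⁴` of complex surfaces, seen as real manifolds. -/
abbrev E4 : Type := EuclideanSpace ℝ (Fin 4)

/-! ### Complex space forms of complex dimension two -/

section Ambient

variable (N : Type*) [TopologicalSpace N] [ChartedSpace E4 N] [IsManifold (𝓡 4) ∞ N]
  [RiemannianBundle (fun y : N ↦ TangentSpace (𝓡 4) y)]
  [IsContMDiffRiemannianBundle (𝓡 4) ∞ E4 (fun y : N ↦ TangentSpace (𝓡 4) y)]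

/-- The curvature `R(X, Y)Z = ∇_X ∇_Y Z - ∇_Y ∇_X Z - ∇_{[X, Y]} Z` of an affine connection, on
vector fields. (In Mathlib, `conn Y y (X y)` is `∇_X Y` at `y`.) -/
def curvature {N : Type*} [TopologicalSpace N] [ChartedSpace E4 N] [IsManifold (𝓡 4) ∞ N]
    (conn : CovariantDerivative (𝓡 4) E4 (fun y : N ↦ TangentSpace (𝓡 4) y))
    (X Y Z : ∀ y : N, TangentSpace (𝓡 4) y) (y : N) : TangentSpace (𝓡 4) y :=
  conn (fun z ↦ conn Z z (Y z)) y (X y) - conn (fun z ↦ conn Z z (X z)) y (Y y)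
    - conn Z y (VectorField.mlieBracket (𝓡 4) X Y y)

instance : IsContMDiffRiemannianBundle (𝓡 4) 1 E4 (fun y : N ↦ TangentSpace (𝓡 4) y) :=
  IsContMDiffRiemannianBundle.of_le (n := ∞) (by norm_cast)

/-- The structure of a complex space form of complex dimension two and constant holomorphic
sectional curvature `4ρ` on a Riemannian manifold `N` of real dimension four: the
Levi-Civita connection `conn` of `N` and a smooth orthogonal almost complex structure `J`, parallel
for `conn` (so that `N` is a Kähler manifold), such that all `J`-invariant tangent planes have
sectional curvature `4ρ`. Neither completeness nor simple connectedness is required. -/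
structure ComplexSpaceForm (ρ : ℝ) where
  /-- the Levi-Civita connection -/
  conn : CovariantDerivative (𝓡 4) E4 (fun y : N ↦ TangentSpace (𝓡 4) y)
  torsion_eq_zero : conn.torsion = 0
  metric : conn.IsMetricCompatible
  /-- the complex structure of the tangent spaces -/
  J : ∀ y : N, TangentSpace (𝓡 4) y →L[ℝ] TangentSpace (𝓡 4) y
  J_smooth : ContMDiff (𝓡 4) ((𝓡 4).prod 𝓘(ℝ, E4 →L[ℝ] E4)) ∞
    (fun y ↦ TotalSpace.mk' (E4 →L[ℝ] E4)
      (E := fun y : N ↦ TangentSpace (𝓡 4) y →L[ℝ] TangentSpace (𝓡 4) y) y (J y))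
  J_sq : ∀ (y : N) (v : TangentSpace (𝓡 4) y), J y (J y v) = -v
  J_inner : ∀ (y : N) (v w : TangentSpace (𝓡 4) y), ⟪J y v, J y w⟫_ℝ = ⟪v, w⟫_ℝ
  J_parallel : ∀ (Y : ∀ y : N, TangentSpace (𝓡 4) y) (y : N),
    MDifferentiableAt (𝓡 4) ((𝓡 4).prod 𝓘(ℝ, E4)) (fun z ↦ (⟨z, Y z⟩ : TangentBundle (𝓡 4) N)) y →
    ∀ v : TangentSpace (𝓡 4) y, conn (fun z ↦ J z (Y z)) y v = J y (conn Y y v)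
  holomorphic_curvature : ∀ (X : ∀ y : N, TangentSpace (𝓡 4) y) (y : N),
    ContMDiffAt (𝓡 4) ((𝓡 4).prod 𝓘(ℝ, E4)) ∞ (fun z ↦ (⟨z, X z⟩ : TangentBundle (𝓡 4) N)) y →
    ⟪curvature conn X (fun z ↦ J z (X z)) (fun z ↦ J z (X z)) y, X y⟫_ℝ = 4 * ρ * ‖X y‖ ^ 4

end Ambient

/-! ### Surfaces -/

section Surface

variable {M : Type*} [TopologicalSpace M] [ChartedSpace E2 M] [IsManifold (𝓡 2) ∞ M]
  [RiemannianBundle (fun p : M ↦ TangentSpace (𝓡 2) p)]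
  [IsContMDiffRiemannianBundle (𝓡 2) ∞ E2 (fun p : M ↦ TangentSpace (𝓡 2) p)]
  {N : Type*} [TopologicalSpace N] [ChartedSpace E4 N] [IsManifold (𝓡 4) ∞ N]
  [RiemannianBundle (fun y : N ↦ TangentSpace (𝓡 4) y)]
  [IsContMDiffRiemannianBundle (𝓡 4) ∞ E4 (fun y : N ↦ TangentSpace (𝓡 4) y)]
  {ρ : ℝ}

instance (p : M) : FiniteDimensional ℝ (TangentSpace (𝓡 2) p) :=
  inferInstanceAs (FiniteDimensional ℝ E2)

variable (M) in
/-- An orientation of the Riemannian surface `M`, given by the field `rot` of rotations of the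
tangent planes by the angle `+π/2`: an orthonormal basis `(e₁, e₂)` of a tangent plane is
positively oriented if and only if `e₂ = rot e₁`. -/
structure SurfaceOrientation where
  rot : ∀ p : M, TangentSpace (𝓡 2) p →L[ℝ] TangentSpace (𝓡 2) p
  rot_smooth : ContMDiff (𝓡 2) ((𝓡 2).prod 𝓘(ℝ, E2 →L[ℝ] E2)) ∞
    (fun p ↦ TotalSpace.mk' (E2 →L[ℝ] E2)
      (E := fun p : M ↦ TangentSpace (𝓡 2) p →L[ℝ] TangentSpace (𝓡 2) p) p (rot p))
  rot_sq : ∀ (p : M) (v : TangentSpace (𝓡 2) p), rot p (rot p v) = -v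
  rot_inner : ∀ (p : M) (v w : TangentSpace (𝓡 2) p), ⟪rot p v, rot p w⟫_ℝ = ⟪v, w⟫_ℝ

/-- Smooth isometric immersions. -/
structure IsIsometricImmersion (x : M → N) : Prop where
  smooth : ContMDiff (𝓡 2) (𝓡 4) ∞ x
  isometric : ∀ (p : M) (v w : TangentSpace (𝓡 2) p),
    ⟪mfderiv (𝓡 2) (𝓡 4) x p v, mfderiv (𝓡 2) (𝓡 4) x p w⟫_ℝ = ⟪v, w⟫_ℝ

/-- The component of `w ∈ T_{x(p)}N` orthogonal to the tangent plane `dx(T_pM)`. -/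
def normalPart (x : M → N) (p : M) (w : TangentSpace (𝓡 4) (x p)) : TangentSpace (𝓡 4) (x p) :=
  w - (LinearMap.range (mfderiv (𝓡 2) (𝓡 4) x p).toLinearMap).starProjection w

/-- The covariant derivative `∇_v V` at `p`, for the connection of the ambient space, of a vector
field `V` along `x : M → N`, in the direction `v ∈ T_pM`. In a local frame `(E_i)` of `TN` with
`V = ∑ V^i (E_i ∘ x)` it is `∑ dV^i(v) E_i + ∑ V^i ∇_{dx(v)} E_i`; the frame used is the coordinate
frame of the preferred chart at `x p`. -/
def covAlong (S : ComplexSpaceForm N ρ) (x : M → N) (V : ∀ q : M, TangentSpace (𝓡 4) (x q))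
    (p : M) (v : TangentSpace (𝓡 2) p) : TangentSpace (𝓡 4) (x p) :=
  (trivializationAt E4 (fun y : N ↦ TangentSpace (𝓡 4) y) (x p)).symmL ℝ (x p)
      (mvfderiv (𝓡 2) (fun q : M ↦
        (trivializationAt E4 (fun y : N ↦ TangentSpace (𝓡 4) y) (x p) ⟨x q, V q⟩).2) p v)
    + S.conn (FiberBundle.extend E4 (V p)) (x p) (mfderiv (𝓡 2) (𝓡 4) x p v)

/-- The second fundamental form `B(v, w) = (∇_v (dx W))^⊥`, where `W` is a vector field on `M`
with value `w` at `p`. -/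
def secondFundamentalForm (S : ComplexSpaceForm N ρ) (x : M → N) (p : M)
    (v w : TangentSpace (𝓡 2) p) : TangentSpace (𝓡 4) (x p) :=
  normalPart x p
    (covAlong S x (fun q ↦ mfderiv (𝓡 2) (𝓡 4) x q (FiberBundle.extend E2 w q)) p v)

/-- The mean curvature vector `H`, half the trace of the second fundamental form. -/
def meanCurvature (S : ComplexSpaceForm N ρ) (x : M → N) (p : M) : TangentSpace (𝓡 4) (x p) :=
  (1 / 2 : ℝ) • ∑ i, secondFundamentalForm S x p
    (stdOrthonormalBasis ℝ (TangentSpace (𝓡 2) p) i)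
    (stdOrthonormalBasis ℝ (TangentSpace (𝓡 2) p) i)

/-- The mean curvature vector is parallel for the normal connection. -/
def HasParallelMeanCurvature (S : ComplexSpaceForm N ρ) (x : M → N) : Prop :=
  ∀ (p : M) (v : TangentSpace (𝓡 2) p),
    normalPart x p (covAlong S x (meanCurvature S x) p v) = 0

/-- The Kähler angle `α ∈ [0, π]`: `cos α = ⟪J dx(e₁), dx(e₂)⟫` for every positively oriented
orthonormal basis `(e₁, e₂)`. Both summands below are of this form, with `(e₁, e₂) = (f, rot f)` for
the two elements `f` of an orthonormal basis. -/
def kaehlerAngle (S : ComplexSpaceForm N ρ) (o : SurfaceOrientation M) (x : M → N) (p : M) : ℝ :=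
  Real.arccos ((1 / 2 : ℝ) * ∑ i,
    ⟪S.J (x p) (mfderiv (𝓡 2) (𝓡 4) x p (stdOrthonormalBasis ℝ (TangentSpace (𝓡 2) p) i)),
      mfderiv (𝓡 2) (𝓡 4) x p (o.rot p (stdOrthonormalBasis ℝ (TangentSpace (𝓡 2) p) i))⟫_ℝ)

/-- The normal vector `e₃` attached to the positively oriented orthonormal basis `(e₁, e₂)` of a
tangent plane by `J dx(e₂) = -cos α dx(e₁) - sin α e₃`. -/
def normalVec3 (S : ComplexSpaceForm N ρ) (o : SurfaceOrientation M) (x : M → N) {p : M}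
    (e₁ e₂ : TangentSpace (𝓡 2) p) : TangentSpace (𝓡 4) (x p) :=
  -(Real.sin (kaehlerAngle S o x p))⁻¹ • (S.J (x p) (mfderiv (𝓡 2) (𝓡 4) x p e₂)
    + Real.cos (kaehlerAngle S o x p) • mfderiv (𝓡 2) (𝓡 4) x p e₁)

/-- The normal vector `e₄` attached to the positively oriented orthonormal basis `(e₁, e₂)` of a
tangent plane by `J dx(e₁) = cos α dx(e₂) + sin α e₄`. -/
def normalVec4 (S : ComplexSpaceForm N ρ) (o : SurfaceOrientation M) (x : M → N) {p : M}
    (e₁ e₂ : TangentSpace (𝓡 2) p) : TangentSpace (𝓡 4) (x p) :=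
  (Real.sin (kaehlerAngle S o x p))⁻¹ • (S.J (x p) (mfderiv (𝓡 2) (𝓡 4) x p e₁)
    - Real.cos (kaehlerAngle S o x p) • mfderiv (𝓡 2) (𝓡 4) x p e₂)

/-- The adapted frames at `p`: positively oriented orthonormal bases `(e₁, e₂)` of `T_pM` for which
`H = -|H| e₃`. If `sin α ≠ 0` and `H ≠ 0` there is exactly one. In terms of the unitary coframe
`(ω₁, ω₂)` of `T_{x(p)}N` that pulls back to `ω₁ = cos(α/2) φ`, `ω₂ = sin(α/2) φ̄`, where
`φ = θ₁ + i θ₂` for the dual basis `(θ₁, θ₂)` of `(e₁, e₂)`, the dual basis of the normal vectors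
is given by `θ₃ + i θ₄ = sin(α/2) ω₁ - cos(α/2) ω̄₂`. -/
structure AdaptedFrame (S : ComplexSpaceForm N ρ) (o : SurfaceOrientation M) (x : M → N)
    (p : M) where
  e₁ : TangentSpace (𝓡 2) p
  e₂ : TangentSpace (𝓡 2) p
  norm_e₁ : ‖e₁‖ = 1
  e₂_eq : e₂ = o.rot p e₁
  meanCurvature_eq :
    meanCurvature S x p = -‖meanCurvature S x p‖ • normalVec3 S o x e₁ e₂

namespace AdaptedFrame

variable {S : ComplexSpaceForm N ρ} {o : SurfaceOrientation M} {x : M → N} {p : M}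

/-- The complex one-form `φ = θ₁ + i θ₂`; the metric of `M` is `φ φ̄`. -/
def phi (F : AdaptedFrame S o x p) (v : TangentSpace (𝓡 2) p) : ℂ :=
  (⟪F.e₁, v⟫_ℝ : ℂ) + Complex.I * (⟪F.e₂, v⟫_ℝ : ℂ)

/-- The complexified second fundamental form `S(v, w) = (θ₃ + i θ₄)(B(v, w))`. -/
def complexForm (F : AdaptedFrame S o x p) (v w : TangentSpace (𝓡 2) p) : ℂ :=
  (⟪normalVec3 S o x F.e₁ F.e₂, secondFundamentalForm S x p v w⟫_ℝ : ℂ)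
    + Complex.I * (⟪normalVec4 S o x F.e₁ F.e₂, secondFundamentalForm S x p v w⟫_ℝ : ℂ)

/-- The component `a = -S(Z, Z)`, where `Z = (e₁ - i e₂) / 2`, of the complexified second
fundamental form. (The component `b = -S(Z, Z̄)` is `|H| / 2`.) -/
def a (F : AdaptedFrame S o x p) : ℂ :=
  -(1 / 4) * (F.complexForm F.e₁ F.e₁ - F.complexForm F.e₂ F.e₂
    - 2 * Complex.I * F.complexForm F.e₁ F.e₂)

end AdaptedFrame

/-- The number `b > 0` given by `2b = |H|`. -/
def halfMean (S : ComplexSpaceForm N ρ) (x : M → N) (p : M) : ℝ := ‖meanCurvature S x p‖ / 2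

/-- The partial derivative of `f` with respect to the `i`-th coordinate of the chart `e`. -/
def chartPartial (e : OpenPartialHomeomorph M E2) (i : Fin 2) (f : M → ℝ) (q : M) : ℝ :=
  fderiv ℝ (f ∘ e.symm) (e q) (EuclideanSpace.single i 1)

/-- The chart `e = (u, v)` of `M` gives isothermal coordinates such that `φ = λ (du + i dv)` for
some complex-valued function `λ`. -/
def IsIsothermal (S : ComplexSpaceForm N ρ) (o : SurfaceOrientation M) (x : M → N)
    (e : OpenPartialHomeomorph M E2) : Prop :=
  e ∈ IsManifold.maximalAtlas (𝓡 2) ∞ M ∧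
  ∀ q ∈ e.source, ∀ F : AdaptedFrame S o x q, ∃ l : ℂ, ∀ w : TangentSpace (𝓡 2) q,
    F.phi w = l * ((mvfderiv (𝓡 2) (fun q' ↦ e q' 0) q w : ℂ)
      + Complex.I * (mvfderiv (𝓡 2) (fun q' ↦ e q' 1) q w : ℂ))

end Surface

end KaehlerPMC

end

open scoped Manifold ContDiff InnerProductSpace
open Bundle

set_option linter.unusedSectionVars false

noncomputable section

/-! The whole lemma rests on one first-order identity. Let `rot` be the rotation of the tangent
planes by a right angle. Differentiating cos α = ⟨J dx(e₁), dx(e₂)⟩ and using ∇J = 0, the tangential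
terms cancel. What remains is dα(w) = -(⟨e₃, B(w, e₁)⟩ + ⟨e₄, B(w, e₂)⟩) wherever sin α ≠ 0. In an
adapted frame H = -|H| e₃ turns this into dα = 2 Re((a + b) φ)
(`AdaptedFrame.mvfderiv_kaehlerAngle_eq_re`). Since φ ∘ rot = iφ, the real part determines the form:
2(a + b) φ = dα - i dα ∘ rot (`AdaptedFrame.two_mul_phi`). In particular a + b ≠ 0 where dα ≠ 0.

The form dα ∘ rot, which is minus the Hodge dual of dα, has no zeros near such a point. A zero-free
one-form in two variables has a local integrating factor: dβ = k dα ∘ rot with k ≠ 0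
(`exists_integratingFactor`, transferred to the surface by `exists_mvfderiv_eq_smul_rot`).
Substitution gives the formula for φ. The forms dα and dα ∘ rot have no common kernel, so (α, β) is
a chart by the inverse function theorem. In isothermal coordinates rot sends ∂_u to ∂_v, so dβ = k
dα ∘ rot reads β_u = kα_v, β_v = -kα_u. The equation for k is then the equality of the mixed second
derivatives of β.

Two degenerate situations need care. The function α = arccos(cos α) may fail to be smooth where sin
α = 0; but α is extremal there, so its derivative vanishes, and such points lie outside the set dα ≠
0. For the existence of points with dα ≠ 0 one argues with cos α, which is smooth everywhere.

The integrating factor comes from the flow of the scalar equation y' = -P/Q for a form P ds + Q dy: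
the initial value, as a function on the plane, is a first integral. The smoothness of this flow in
all variables is proved from Picard-Lindelöf, with an explicit exponential formula for the
derivative in the initial value. -/

namespace KaehlerPMC

/-! ### Smooth dependence of integrals on parameters. -/

section

open Set MeasureTheory Filter Topology

/-- Smooth dependence of integrals over `[0, 1]` on parameters. -/
theorem contDiffOn_integral_unitInterval {P : Type*} [NormedAddCommGroup P] [NormedSpace ℝ P]
    {n : ℕ∞} {s : Set P} (hs : IsOpen s) {U : Set ℝ} (hU : IsOpen U) (h01 : Icc 0 1 ⊆ U)
    {h : P × ℝ → ℝ} (hh : ContDiffOn ℝ n h (s ×ˢ U)) :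
    ContDiffOn ℝ n (fun p ↦ ∫ θ in (0 : ℝ)..1, h (p, θ)) s := by
  obtain ⟨t, ht, h0t, htU⟩ := exists_compact_between isCompact_Icc hU h01
  obtain ⟨φ, hφ1, hφ0, -⟩ := exists_contMDiffMap_one_nhds_of_subset_interior (n := ⊤)
    𝓘(ℝ, ℝ) (s := Icc (0 : ℝ) 1) (t := t) isClosed_Icc h0t
  have hφs : ContDiff ℝ ∞ φ := φ.contMDiff.contDiff
  set g : P → ℝ → ℝ := fun p y ↦ φ (-y) * h (p, -y) with hg
  -- The integral is the value at 0 of the convolution of the indicator of (0, 1] with y ↦ φ(-y)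
  -- h(p, -y). The cutoff φ, equal to 1 near [0, 1], supplies the compact support in y.
  have hconv := contDiffOn_convolution_right_with_param (𝕜 := ℝ) (μ := volume)
    (f := (Ioc (0 : ℝ) 1).indicator (fun _ ↦ (1 : ℝ))) (n := n) (ContinuousLinearMap.mul ℝ ℝ)
    (g := g) (s := s) (k := -t) hs ht.neg
    (fun p x _ hx ↦ by simp only [hg]; rw [hφ0 (-x) (by simpa using hx), zero_mul])
    (((integrable_indicator_iff measurableSet_Ioc).2 (by simp)).locallyIntegrable) ?_
  · have h2 : ContDiffOn ℝ n (fun p : P ↦ (p, (0 : ℝ))) s := by fun_prop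
    refine (hconv.comp h2 (fun p hp ↦ ⟨hp, mem_univ _⟩)).congr fun p _ ↦ ?_
    simp only [Function.comp, convolution_def, ContinuousLinearMap.mul_apply', hg, zero_sub,
      neg_neg]
    rw [intervalIntegral.integral_of_le zero_le_one, ← integral_indicator measurableSet_Ioc]
    congr 1
    ext x
    by_cases hx : x ∈ Ioc (0 : ℝ) 1
    · have := hφ1.self_of_nhdsSet x ⟨hx.1.le, hx.2⟩
      simp [hx, this]
    · simp [hx]
  · rintro ⟨p, y⟩ ⟨hp, -⟩
    refine ContDiffAt.contDiffWithinAt ?_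
    by_cases hy : -y ∈ U
    · have h1 : ContDiffAt ℝ n h (p, -y) := hh.contDiffAt ((hs.prod hU).mem_nhds ⟨hp, hy⟩)
      have h2 : ContDiffAt ℝ n (fun z : P × ℝ ↦ (z.1, -z.2)) (p, y) := by fun_prop
      have h3 : ContDiffAt ℝ n (fun z : P × ℝ ↦ φ (-z.2)) (p, y) :=
        ((hφs.of_le (by exact_mod_cast le_top)).comp (by fun_prop :
          ContDiff ℝ n fun z : P × ℝ ↦ -z.2)).contDiffAt
      exact h3.mul (h1.comp (p, y) h2)
    -- Outside `U` nothing is known about `h`, but there the cutoff vanishes on a neighbourhood.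
    · have hy' : y ∉ -t := fun h ↦ hy (htU (by simpa using h))
      refine (contDiffAt_const (c := (0 : ℝ))).congr_of_eventuallyEq ?_
      have : ∀ᶠ z : P × ℝ in 𝓝 (p, y), z.2 ∉ -t :=
        (continuous_snd.isOpen_preimage _ ht.neg.isClosed.isOpen_compl).mem_nhds hy'
      filter_upwards [this] with z hz
      change φ (-z.2) * h (z.1, -z.2) = 0
      rw [hφ0 (-z.2) (by simpa using hz), zero_mul]

/-- The substitution σ = s₀ + (s - s₀)θ moves the variable endpoint into the integrand, leaving an
integral over [0, 1]. -/
theorem contDiffOn_primitive {n : ℕ∞} {a b s₀ : ℝ} (h₀ : s₀ ∈ Ioo a b) {J : Set ℝ}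
    (hJ : IsOpen J) {h : ℝ × ℝ → ℝ} (hh : ContDiffOn ℝ n h (Ioo a b ×ˢ J)) :
    ContDiffOn ℝ n (fun z : ℝ × ℝ ↦ ∫ σ in s₀..z.1, h (σ, z.2)) (Ioo a b ×ˢ J) := by
  rintro ⟨s₁, η₁⟩ ⟨hs₁, hη₁⟩
  refine ContDiffAt.contDiffWithinAt ?_
  have hcont : Continuous fun p : ℝ × ℝ ↦ s₀ + (p.1 - s₀) * p.2 := by fun_prop
  -- The integrand must be smooth for θ in an open set containing [0, 1], uniformly for s near s₁;
  -- compactness of [0, 1] provides it.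
  obtain ⟨u, v, hu, hv, hsu, h01, huv⟩ := generalized_tube_lemma (s := {s₁}) isCompact_singleton
    (t := Icc (0 : ℝ) 1) isCompact_Icc (n := (fun p : ℝ × ℝ ↦ s₀ + (p.1 - s₀) * p.2) ⁻¹' Ioo a b)
    (isOpen_Ioo.preimage hcont) (by
      rintro ⟨s, θ⟩ ⟨hs, hθ⟩
      obtain rfl : s = s₁ := hs
      have := (convex_Ioo a b).add_smul_sub_mem h₀ hs₁ hθ
      simpa [mul_comm] using this)
  have key : ContDiffOn ℝ n (fun z : ℝ × ℝ ↦
      ∫ θ in (0 : ℝ)..1, h (s₀ + (z.1 - s₀) * θ, z.2)) (u ×ˢ J) := by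
    refine contDiffOn_integral_unitInterval (hu.prod hJ) hv h01
      (h := fun p ↦ h (s₀ + (p.1.1 - s₀) * p.2, p.1.2)) ?_
    have : ContDiffOn ℝ n (fun p : (ℝ × ℝ) × ℝ ↦ (s₀ + (p.1.1 - s₀) * p.2, p.1.2))
        ((u ×ˢ J) ×ˢ v) := by fun_prop
    exact hh.comp this fun p hp ↦ ⟨huv (⟨hp.1.1, hp.2⟩ : (p.1.1, p.2) ∈ u ×ˢ v), hp.1.2⟩
  have h2 : ContDiffAt ℝ n (fun z : ℝ × ℝ ↦ z.1 - s₀) (s₁, η₁) := by fun_prop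
  refine (h2.mul (key.contDiffAt ((hu.prod hJ).mem_nhds
    ⟨hsu rfl, hη₁⟩))).congr_of_eventuallyEq (.of_forall fun z ↦ ?_)
  have := intervalIntegral.smul_integral_comp_add_mul (a := 0) (b := 1) (fun σ ↦ h (σ, z.2))
    (z.1 - s₀) s₀
  simp only [smul_eq_mul, mul_zero, add_zero, mul_one, add_sub_cancel] at this
  exact this.symm

end

/-! ### Smooth flow of a scalar ordinary differential equation. -/

section

open Set MeasureTheory Filter Topology

/-- Adding time as a first coordinate makes the equation autonomous, with field (1, g), so that
Picard-Lindelöf for a C¹ field applies and gives joint continuity. -/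
theorem exists_continuousOn_flow {g : ℝ × ℝ → ℝ} (hg : ContDiff ℝ 1 g) (s₀ t₀ : ℝ) :
    ∃ δ > 0, ∃ Y : ℝ × ℝ → ℝ,
      ContinuousOn Y (Icc (s₀ - δ) (s₀ + δ) ×ˢ Icc (t₀ - δ) (t₀ + δ)) ∧
      ∀ η ∈ Icc (t₀ - δ) (t₀ + δ), Y (s₀, η) = η ∧ ∀ s ∈ Icc (s₀ - δ) (s₀ + δ),
        HasDerivWithinAt (fun s ↦ Y (s, η)) (g (s, Y (s, η))) (Icc (s₀ - δ) (s₀ + δ)) s := by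
  have hF : ContDiffAt ℝ 1 (fun z : ℝ × ℝ ↦ ((1 : ℝ), g z)) (s₀, t₀) := by fun_prop
  obtain ⟨ε, hε, a, r, L, K, hr, hpl⟩ := IsPicardLindelof.of_contDiffAt_one hF
  obtain ⟨A, hA, hAc⟩ := (hpl s₀).exists_forall_mem_closedBall_eq_hasDerivWithinAt_continuousOn
  have hδ : 0 < min ε r := lt_min hε hr
  have hmem : ∀ η ∈ Icc (t₀ - min ε r) (t₀ + min ε r),
      (s₀, η) ∈ Metric.closedBall (s₀, t₀) (r : ℝ) := by
    intro η hη
    rw [Metric.mem_closedBall, Prod.dist_eq, dist_self, Real.dist_eq]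
    refine max_le hr.le (abs_le.2 ⟨?_, ?_⟩) <;> linarith [hη.1, hη.2, min_le_right ε (r : ℝ)]
  have hsub : Icc (s₀ - min ε r) (s₀ + min ε r) ⊆ Icc (s₀ - ε) (s₀ + ε) :=
    Icc_subset_Icc (by linarith [min_le_left ε (r : ℝ)]) (by linarith [min_le_left ε (r : ℝ)])
  have hs₀ : s₀ ∈ Icc (s₀ - ε) (s₀ + ε) := ⟨by linarith, by linarith⟩
  refine ⟨min ε r, hδ, fun z ↦ (A ((s₀, z.2), z.1)).2, ?_, fun η hη ↦ ⟨?_, fun s hs ↦ ?_⟩⟩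
  · refine continuous_snd.comp_continuousOn (hAc.comp (by fun_prop) ?_)
    rintro ⟨s, η⟩ ⟨hs, hη⟩
    exact ⟨hmem η hη, hsub hs⟩
  · have := (hA _ (hmem η hη)).1
    simp only [this]
  · have hd := (hA _ (hmem η hη)).2
    -- The first coordinate has derivative 1 and starts at s₀, so it is time itself.
    have h1 : ∀ t ∈ Icc (s₀ - ε) (s₀ + ε), (A ((s₀, η), t)).1 = t := by
      intro t ht
      have hc := (convex_Icc (s₀ - ε) (s₀ + ε)).norm_image_sub_le_of_norm_hasDerivWithin_le
        (f := fun t ↦ (A ((s₀, η), t)).1 - t) (f' := fun _ ↦ 0) (C := 0)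
        (fun t ht ↦ by
          have := ((hasFDerivAt_fst (𝕜 := ℝ) (p := A ((s₀, η), t))).comp_hasDerivWithinAt t
            (hd t ht)).sub (hasDerivWithinAt_id t _)
          exact this.congr_deriv (by simp)) (by simp) hs₀ ht
      have h0 := (hA _ (hmem η hη)).1
      simp only [zero_mul, norm_le_zero_iff] at hc
      simp only [h0, sub_self, sub_zero] at hc
      linarith
    have h2 := (hasFDerivAt_snd (𝕜 := ℝ) (p := A ((s₀, η), s))).comp_hasDerivWithinAt s
      ((hd s (hsub hs)).mono hsub)
    have h3 : A ((s₀, η), s) = (s, (A ((s₀, η), s)).2) := Prod.ext (h1 s (hsub hs)) rfl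
    rw [← h3]
    exact h2

/-- Hadamard's form of the mean value theorem: the factor is continuous in both endpoints, including
where they coincide. -/
theorem sub_eq_integral_mul {g : ℝ × ℝ → ℝ} (hg : ContDiff ℝ 1 g) (s y₁ y₂ : ℝ) :
    g (s, y₂) - g (s, y₁)
      = (∫ θ in (0 : ℝ)..1, fderiv ℝ g (s, y₁ + θ * (y₂ - y₁)) (0, 1)) * (y₂ - y₁) := by
  have hd : ∀ θ ∈ uIcc (0 : ℝ) 1, HasDerivAt (fun θ ↦ g (s, y₁ + θ * (y₂ - y₁)))
      (fderiv ℝ g (s, y₁ + θ * (y₂ - y₁)) (0, 1) * (y₂ - y₁)) θ := by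
    intro θ _
    have h1 : HasDerivAt (fun θ : ℝ ↦ (s, y₁ + θ * (y₂ - y₁))) (0, y₂ - y₁) θ :=
      (hasDerivAt_const θ s).prodMk (by simpa using ((hasDerivAt_id θ).mul_const (y₂ - y₁)).const_add y₁)
    have h2 := ((hg.differentiable one_ne_zero) (s, y₁ + θ * (y₂ - y₁))).hasFDerivAt.comp_hasDerivAt θ h1
    have h3 : ((0 : ℝ), y₂ - y₁) = (y₂ - y₁) • ((0 : ℝ), (1 : ℝ)) := by simp
    rw [h3, map_smul, smul_eq_mul, mul_comm] at h2
    exact h2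
  have hc : Continuous fun θ : ℝ ↦ fderiv ℝ g (s, y₁ + θ * (y₂ - y₁)) (0, 1) * (y₂ - y₁) :=
    (((hg.continuous_fderiv one_ne_zero).comp (by fun_prop)).clm_apply continuous_const).mul
      continuous_const
  have := intervalIntegral.integral_eq_sub_of_hasDerivAt hd (hc.intervalIntegrable 0 1)
  rw [intervalIntegral.integral_mul_const] at this
  simpa using this.symm

/-- Local flow of a scalar ODE, with its derivative with respect to the initial value. -/
theorem exists_flow_hasDerivAt {g : ℝ × ℝ → ℝ} (hg : ContDiff ℝ 1 g) (s₀ t₀ : ℝ) :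
    ∃ δ > 0, ∃ Y : ℝ × ℝ → ℝ, ContinuousOn Y (Ioo (s₀ - δ) (s₀ + δ) ×ˢ Ioo (t₀ - δ) (t₀ + δ)) ∧
      ∀ s ∈ Ioo (s₀ - δ) (s₀ + δ), ∀ η ∈ Ioo (t₀ - δ) (t₀ + δ), Y (s₀, η) = η ∧
        HasDerivAt (fun s ↦ Y (s, η)) (g (s, Y (s, η))) s ∧
        HasDerivAt (fun η ↦ Y (s, η))
          (Real.exp (∫ σ in s₀..s, fderiv ℝ g (σ, Y (σ, η)) (0, 1))) η := by
  obtain ⟨δ, hδ, Y, hYc, hY⟩ := exists_continuousOn_flow hg s₀ t₀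
  have hsI : s₀ - δ ≤ s₀ + δ := by linarith
  have htI : t₀ - δ ≤ t₀ + δ := by linarith
  -- Clamping the arguments extends the flow continuously to the whole plane, so the integrals below
  -- are continuous without side conditions.
  set Z : ℝ → ℝ → ℝ := fun s η ↦ Y (projIcc _ _ hsI s, projIcc _ _ htI η) with hZ
  have hZc : Continuous fun z : ℝ × ℝ ↦ Z z.1 z.2 :=
    hYc.comp_continuous (by fun_prop) fun z ↦ ⟨Subtype.coe_prop _, Subtype.coe_prop _⟩
  have hZY : ∀ s ∈ Icc (s₀ - δ) (s₀ + δ), ∀ η ∈ Icc (t₀ - δ) (t₀ + δ), Z s η = Y (s, η) := by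
    intro s hs η hη
    simp only [hZ, projIcc_of_mem hsI hs, projIcc_of_mem htI hη]
  -- The difference D of the two solutions with initial values `w.1` and `w.2` satisfies the linear
  -- equation D' = c D.
  set c : (ℝ × ℝ) → ℝ → ℝ := fun w σ ↦ ∫ θ in (0 : ℝ)..1,
    fderiv ℝ g (σ, Z σ w.1 + θ * (Z σ w.2 - Z σ w.1)) (0, 1) with hc
  have hcc : Continuous fun q : (ℝ × ℝ) × ℝ ↦ c q.1 q.2 := by
    refine intervalIntegral.continuous_parametric_intervalIntegral_of_continuous'
      (f := fun (q : (ℝ × ℝ) × ℝ) θ ↦ fderiv ℝ g (q.2, Z q.2 q.1.1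
        + θ * (Z q.2 q.1.2 - Z q.2 q.1.1)) (0, 1)) ?_ 0 1
    refine Continuous.clm_apply ((hg.continuous_fderiv one_ne_zero).comp ?_) continuous_const
    have h1 : Continuous fun q : ((ℝ × ℝ) × ℝ) × ℝ ↦ Z q.1.2 q.1.1.1 :=
      hZc.comp (f := fun q : ((ℝ × ℝ) × ℝ) × ℝ ↦ (q.1.2, q.1.1.1)) (by fun_prop)
    have h2 : Continuous fun q : ((ℝ × ℝ) × ℝ) × ℝ ↦ Z q.1.2 q.1.1.2 :=
      hZc.comp (f := fun q : ((ℝ × ℝ) × ℝ) × ℝ ↦ (q.1.2, q.1.1.2)) (by fun_prop)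
    fun_prop
  have hEc : ∀ s, Continuous fun w : ℝ × ℝ ↦ Real.exp (∫ σ in s₀..s, c w σ) := fun s ↦
    Real.continuous_exp.comp
      (intervalIntegral.continuous_parametric_intervalIntegral_of_continuous' hcc s₀ s)
  have hs₀ : s₀ ∈ Ioo (s₀ - δ) (s₀ + δ) := ⟨by linarith, by linarith⟩
  have hdiff : ∀ s ∈ Ioo (s₀ - δ) (s₀ + δ), ∀ η ∈ Ioo (t₀ - δ) (t₀ + δ),
      HasDerivAt (fun s ↦ Y (s, η)) (g (s, Y (s, η))) s := fun s hs η hη ↦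
    ((hY η (Ioo_subset_Icc_self hη)).2 s (Ioo_subset_Icc_self hs)).hasDerivAt
      (Icc_mem_nhds hs.1 hs.2)
  have key : ∀ s ∈ Ioo (s₀ - δ) (s₀ + δ), ∀ η₁ ∈ Ioo (t₀ - δ) (t₀ + δ),
      ∀ η₂ ∈ Ioo (t₀ - δ) (t₀ + δ),
      Y (s, η₂) - Y (s, η₁) = Real.exp (∫ σ in s₀..s, c (η₁, η₂) σ) * (η₂ - η₁) := by
    intro s hs η₁ hη₁ η₂ hη₂
    have hcw : Continuous (c (η₁, η₂)) := hcc.comp (f := fun σ ↦ ((η₁, η₂), σ)) (by fun_prop)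
    -- The difference of the solutions times exp(-∫c) has derivative zero, hence keeps its initial
    -- value η₂ - η₁.
    have hconst := (convex_Ioo (s₀ - δ) (s₀ + δ)).norm_image_sub_le_of_norm_hasDerivWithin_le
        (f := fun t ↦ (Y (t, η₂) - Y (t, η₁)) * Real.exp (-∫ σ in s₀..t, c (η₁, η₂) σ))
        (f' := fun _ ↦ 0) (C := 0)
        (fun t ht ↦ by
          have h1 := (hdiff t ht η₂ hη₂).sub (hdiff t ht η₁ hη₁)
          have h2 := (intervalIntegral.integral_hasDerivAt_right (hcw.intervalIntegrable s₀ t)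
            (hcw.stronglyMeasurableAtFilter _ _) hcw.continuousAt).neg.exp
          refine (h1.mul h2).hasDerivWithinAt.congr_deriv ?_
          have h3 := sub_eq_integral_mul hg t (Y (t, η₁)) (Y (t, η₂))
          have h4 : c (η₁, η₂) t = ∫ θ in (0 : ℝ)..1,
              fderiv ℝ g (t, Y (t, η₁) + θ * (Y (t, η₂) - Y (t, η₁))) (0, 1) := by
            simp only [hc, hZY t (Ioo_subset_Icc_self ht) _ (Ioo_subset_Icc_self hη₁),
              hZY t (Ioo_subset_Icc_self ht) _ (Ioo_subset_Icc_self hη₂)]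
          rw [h3, ← h4]
          simp only [Pi.sub_apply, Pi.neg_apply]
          ring) (by simp) hs₀ hs
    simp only [zero_mul, norm_le_zero_iff, intervalIntegral.integral_same, neg_zero, Real.exp_zero,
      mul_one, (hY η₁ (Ioo_subset_Icc_self hη₁)).1, (hY η₂ (Ioo_subset_Icc_self hη₂)).1,
      sub_eq_zero, Real.exp_neg] at hconst
    rw [← hconst]
    field_simp
  refine ⟨δ, hδ, Y, hYc.mono (prod_mono Ioo_subset_Icc_self Ioo_subset_Icc_self),
    fun s hs η hη ↦ ⟨(hY η (Ioo_subset_Icc_self hη)).1, hdiff s hs η hη, ?_⟩⟩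
  have hE : ∫ σ in s₀..s, fderiv ℝ g (σ, Y (σ, η)) (0, 1) = ∫ σ in s₀..s, c (η, η) σ := by
    refine intervalIntegral.integral_congr fun σ hσ ↦ ?_
    have hσ' : σ ∈ Icc (s₀ - δ) (s₀ + δ) :=
      uIcc_subset_Icc (Ioo_subset_Icc_self hs₀) (Ioo_subset_Icc_self hs) hσ
    simp [hc, hZY σ hσ' η (Ioo_subset_Icc_self hη)]
  rw [hE, hasDerivAt_iff_tendsto_slope]
  -- The difference quotient in the initial value is exactly exp(∫c), which is continuous up to the
  -- diagonal η' = η.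
  have ht : Tendsto (fun η' ↦ Real.exp (∫ σ in s₀..s, c (η, η') σ)) (𝓝[≠] η)
      (𝓝 (Real.exp (∫ σ in s₀..s, c (η, η) σ))) :=
    (((hEc s).comp (f := fun η' ↦ (η, η')) (by fun_prop)).tendsto η).mono_left nhdsWithin_le_nhds
  refine ht.congr' ?_
  filter_upwards [self_mem_nhdsWithin, nhdsWithin_le_nhds (isOpen_Ioo.mem_nhds hη)] with η' hne hη'
  rw [slope_def_field, key s hs η hη η' hη', mul_div_cancel_right₀ _ (sub_ne_zero.2 hne)]

/-- Smoothness of the local flow of a scalar ODE. -/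
theorem exists_flow_contDiffOn {g : ℝ × ℝ → ℝ} (hg : ContDiff ℝ ∞ g) (s₀ t₀ : ℝ) :
    ∃ δ > 0, ∃ Y E : ℝ × ℝ → ℝ,
      ContDiffOn ℝ ∞ Y (Ioo (s₀ - δ) (s₀ + δ) ×ˢ Ioo (t₀ - δ) (t₀ + δ)) ∧
      ContDiffOn ℝ ∞ E (Ioo (s₀ - δ) (s₀ + δ) ×ˢ Ioo (t₀ - δ) (t₀ + δ)) ∧
      ∀ z ∈ Ioo (s₀ - δ) (s₀ + δ) ×ˢ Ioo (t₀ - δ) (t₀ + δ), Y (s₀, z.2) = z.2 ∧ 0 < E z ∧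
        HasStrictFDerivAt Y (g (z.1, Y z) • ContinuousLinearMap.fst ℝ ℝ ℝ
          + E z • ContinuousLinearMap.snd ℝ ℝ ℝ) z := by
  obtain ⟨δ, hδ, Y, hYc, hY⟩ := exists_flow_hasDerivAt (hg.of_le (by exact_mod_cast le_top)) s₀ t₀
  set V := Ioo (s₀ - δ) (s₀ + δ) ×ˢ Ioo (t₀ - δ) (t₀ + δ) with hV
  have hVo : IsOpen V := isOpen_Ioo.prod isOpen_Ioo
  set E : ℝ × ℝ → ℝ := fun z ↦ Real.exp (∫ σ in s₀..z.1, fderiv ℝ g (σ, Y (σ, z.2)) (0, 1)) with hE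
  have hs₀ : s₀ ∈ Ioo (s₀ - δ) (s₀ + δ) := ⟨by linarith, by linarith⟩
  have hg' : ContDiff ℝ ∞ fun z ↦ fderiv ℝ g z (0, 1) :=
    (hg.fderiv_right (by simp)).clm_apply contDiff_const
  have hEn : ∀ n : ℕ, ContDiffOn ℝ n Y V → ContDiffOn ℝ n E V := by
    intro n hn
    have h1 : ContDiffOn ℝ n (fun z : ℝ × ℝ ↦ fderiv ℝ g (z.1, Y z) (0, 1)) V :=
      (hg'.of_le (by exact_mod_cast le_top)).comp_contDiffOn (contDiff_fst.contDiffOn.prodMk hn)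
    exact Real.contDiff_exp.comp_contDiffOn (contDiffOn_primitive (n := n) hs₀ isOpen_Ioo h1)
  have hE0 : ContinuousOn E V := (contDiffOn_zero.1 (hEn 0 (contDiffOn_zero.2 hYc)))
  have hgY : ContinuousOn (fun z : ℝ × ℝ ↦ g (z.1, Y z)) V :=
    hg.continuous.comp_continuousOn (continuous_fst.continuousOn.prodMk hYc)
  have hstrict : ∀ z ∈ V, HasStrictFDerivAt Y (g (z.1, Y z) • ContinuousLinearMap.fst ℝ ℝ ℝ
          + E z • ContinuousLinearMap.snd ℝ ℝ ℝ) z := by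
    intro z hz
    have hev : ∀ᶠ w in 𝓝 z, w ∈ V := hVo.mem_nhds hz
    have hc : ∀ f : ℝ × ℝ → ℝ, ContinuousOn f V → ContinuousAt
        (fun z ↦ ContinuousLinearMap.toSpanSingleton ℝ (f z)) z := fun f hf ↦
      (ContinuousLinearMap.toSpanSingletonCLE (𝕜 := ℝ)
        (E := ℝ)).continuous.continuousAt.comp (hf.continuousAt (hVo.mem_nhds hz))
    have := hasStrictFDerivAt_uncurry_coprod (𝕜 := ℝ) (u := z) (f := fun s η ↦ Y (s, η))
      (f₁ := fun s η ↦ ContinuousLinearMap.toSpanSingleton ℝ (g (s, Y (s, η))))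
      (f₂ := fun s η ↦ ContinuousLinearMap.toSpanSingleton ℝ (E (s, η)))
      (hev.mono fun w hw ↦ (hY w.1 hw.1 w.2 hw.2).2.1.hasFDerivAt)
      (hev.mono fun w hw ↦ (hY w.1 hw.1 w.2 hw.2).2.2.hasFDerivAt)
      (hc _ hgY) (hc _ hE0)
    refine this.congr_fderiv ?_
    ext <;> simp [Function.HasUncurry.uncurry]
  -- Bootstrap: dY = g(s, Y) ds + E dη, and `E` is an exponential of an integral involving Y, so if
  -- Y is Cⁿ, then so is dY.
  have hYn : ∀ n : ℕ, ContDiffOn ℝ n Y V := by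
    intro n
    induction n with
    | zero => exact contDiffOn_zero.2 hYc
    | succ n ih =>
      rw [Nat.cast_succ, contDiffOn_succ_iff_fderiv_of_isOpen hVo]
      refine ⟨fun z hz ↦ (hstrict z hz).hasFDerivAt.differentiableAt.differentiableWithinAt,
        by simp, ?_⟩
      have h1 : ContDiffOn ℝ n (fun z : ℝ × ℝ ↦ g (z.1, Y z)) V :=
        (hg.of_le (by exact_mod_cast le_top)).comp_contDiffOn (contDiff_fst.contDiffOn.prodMk ih)
      exact ((h1.smul contDiffOn_const).add ((hEn n ih).smul contDiffOn_const)).congr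
        fun z hz ↦ (hstrict z hz).hasFDerivAt.fderiv
  refine ⟨δ, hδ, Y, E, contDiffOn_infty.2 hYn, contDiffOn_infty.2 fun n ↦ hEn n (hYn n),
    fun z hz ↦ ⟨(hY z.1 hz.1 z.2 hz.2).1, Real.exp_pos _, hstrict z hz⟩⟩

end

/-! ### Integrating factors for one-forms in the plane. -/

section

open Set MeasureTheory Filter Topology

/-- The invertible linear map `(s, t) ↦ (s, g s + c t)`. -/
def shearEquiv (g : ℝ) {c : ℝ} (hc : c ≠ 0) : (ℝ × ℝ) ≃L[ℝ] (ℝ × ℝ) :=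
  ContinuousLinearEquiv.equivOfInverse
    ((ContinuousLinearMap.fst ℝ ℝ ℝ).prod
      (g • ContinuousLinearMap.fst ℝ ℝ ℝ + c • ContinuousLinearMap.snd ℝ ℝ ℝ))
    ((ContinuousLinearMap.fst ℝ ℝ ℝ).prod
      (c⁻¹ • (ContinuousLinearMap.snd ℝ ℝ ℝ - g • ContinuousLinearMap.fst ℝ ℝ ℝ)))
    (fun z ↦ by ext <;> simp; field_simp)
    (fun z ↦ by ext <;> simp; field_simp; ring)

/-- The integral curves of the kernel of P ds + Q dy are the graphs of solutions of y' = -P/Q. The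
initial value β of the solution through a point is constant along them. Inverting (s, η) ↦ (s, Y(s,
η)), whose η-derivative is (0, E), gives dβ = (dy + (P/Q) ds)/E, hence k = 1/(EQ). -/
theorem exists_integratingFactor_prod {P Q : ℝ × ℝ → ℝ} {U : Set (ℝ × ℝ)} (hU : IsOpen U)
    (hP : ContDiffOn ℝ ∞ P U) (hQ : ContDiffOn ℝ ∞ Q U) {z₀ : ℝ × ℝ} (hz₀ : z₀ ∈ U)
    (hQ₀ : Q z₀ ≠ 0) :
    ∃ O ⊆ U, IsOpen O ∧ z₀ ∈ O ∧ ∃ β k : ℝ × ℝ → ℝ, ContDiffOn ℝ ∞ β O ∧ ContDiffOn ℝ ∞ k O ∧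
      ∀ z ∈ O, k z ≠ 0 ∧ HasFDerivAt β (k z • (P z • ContinuousLinearMap.fst ℝ ℝ ℝ
        + Q z • ContinuousLinearMap.snd ℝ ℝ ℝ)) z := by
  set U' := U ∩ Q ⁻¹' {0}ᶜ with hU'
  have hU'o : IsOpen U' := hQ.continuousOn.isOpen_inter_preimage hU isOpen_compl_singleton
  obtain ⟨r, hr, hrU⟩ := Metric.isOpen_iff.1 hU'o z₀ ⟨hz₀, hQ₀⟩
  -- The cutoff makes -P/Q a smooth function on the whole plane, as the flow lemma demands; it
  -- equals 1 on the ball of radius r/4, to which `O` is restricted.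
  let φ : ContDiffBump z₀ := ⟨r / 4, r / 2, by positivity, by linarith⟩
  have hφU : tsupport φ ⊆ U' := by
    rw [φ.tsupport_eq]
    exact (Metric.closedBall_subset_ball (by change r / 2 < r; linarith)).trans hrU
  set g₀ : ℝ × ℝ → ℝ := fun z ↦ -(P z / Q z) with hg₀
  have hg₀s : ContDiffOn ℝ ∞ g₀ U' :=
    ((hP.mono inter_subset_left).div (hQ.mono inter_subset_left) fun z hz ↦ hz.2).neg
  set g : ℝ × ℝ → ℝ := fun z ↦ φ z * g₀ z with hg
  have hgs : ContDiff ℝ ∞ g := by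
    refine contDiff_iff_contDiffAt.2 fun z ↦ ?_
    by_cases hz : z ∈ U'
    · exact φ.contDiff.contDiffAt.mul (hg₀s.contDiffAt (hU'o.mem_nhds hz))
    · have hz' : z ∉ tsupport φ := fun h ↦ hz (hφU h)
      refine (contDiffAt_const (c := (0 : ℝ))).congr_of_eventuallyEq ?_
      filter_upwards [(isClosed_tsupport φ).isOpen_compl.mem_nhds hz'] with w hw
      simp [hg, image_eq_zero_of_notMem_tsupport hw]
  obtain ⟨δ, hδ, Y, E, hYs, hEs, hY⟩ := exists_flow_contDiffOn hgs z₀.1 z₀.2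
  set V := Ioo (z₀.1 - δ) (z₀.1 + δ) ×ˢ Ioo (z₀.2 - δ) (z₀.2 + δ) with hV
  have hVo : IsOpen V := isOpen_Ioo.prod isOpen_Ioo
  have hz₀V : z₀ ∈ V := ⟨⟨by linarith, by linarith⟩, ⟨by linarith, by linarith⟩⟩
  have hΦ : ∀ z (hz : z ∈ V), HasStrictFDerivAt (fun w : ℝ × ℝ ↦ (w.1, Y w))
      (shearEquiv (g (z.1, Y z)) (hY z hz).2.1.ne' : (ℝ × ℝ) →L[ℝ] (ℝ × ℝ)) z := fun z hz ↦
    hasStrictFDerivAt_fst.prodMk (hY z hz).2.2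
  set e := (hΦ z₀ hz₀V).toOpenPartialHomeomorph with he
  have hecoe : ∀ w, e w = (w.1, Y w) := fun w ↦ rfl
  have hez₀ : e z₀ = z₀ := Prod.ext rfl (hY z₀ hz₀V).1
  have hz₀s : z₀ ∈ e.source := (hΦ z₀ hz₀V).mem_toOpenPartialHomeomorph_source
  have hz₀t : z₀ ∈ e.target := hez₀ ▸ e.map_source hz₀s
  have hez₀' : e.symm z₀ = z₀ := by
    conv_lhs => rw [← hez₀]
    exact e.left_inv hz₀s
  set O := (e.target ∩ e.symm ⁻¹' V) ∩ Metric.ball z₀ (r / 4) with hO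
  have hOo : IsOpen O := (e.isOpen_inter_preimage_symm hVo).inter Metric.isOpen_ball
  have hOU : O ⊆ U' := inter_subset_right.trans
    ((Metric.ball_subset_ball (by linarith)).trans hrU)
  have hder : ∀ z ∈ O, ∃ h : E (e.symm z) ≠ 0, HasFDerivAt e (shearEquiv (g z) h :
      (ℝ × ℝ) →L[ℝ] (ℝ × ℝ)) (e.symm z) := by
    intro z hz
    have h1 := (hΦ _ hz.1.2).hasFDerivAt
    have h2 : ((e.symm z).1, Y (e.symm z)) = z := e.right_inv hz.1.1
    refine ⟨(hY _ hz.1.2).2.1.ne', ?_⟩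
    simp only [h2] at h1
    exact h1
  have hsymm : ContDiffOn ℝ ∞ e.symm O := fun z hz ↦ by
    obtain ⟨h, hd⟩ := hder z hz
    exact (e.contDiffAt_symm hz.1.1 hd ((contDiff_fst.contDiffAt).prodMk
      (hYs.contDiffAt (hVo.mem_nhds hz.1.2)))).contDiffWithinAt
  have hEO : ContDiffOn ℝ ∞ (fun z ↦ E (e.symm z)) O := hEs.comp hsymm fun z hz ↦ hz.1.2
  have hEQ : ∀ z ∈ O, E (e.symm z) * Q z ≠ 0 := fun z hz ↦
    mul_ne_zero (hder z hz).1 (hOU hz).2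
  refine ⟨O, hOU.trans inter_subset_left, hOo,
    ⟨⟨hz₀t, by rw [mem_preimage, hez₀']; exact hz₀V⟩, Metric.mem_ball_self (by positivity)⟩,
    fun z ↦ (e.symm z).2, fun z ↦ (E (e.symm z) * Q z)⁻¹, contDiff_snd.comp_contDiffOn hsymm,
    (hEO.mul (hQ.mono (hOU.trans inter_subset_left))).inv hEQ, fun z hz ↦ ⟨inv_ne_zero (hEQ z hz), ?_⟩⟩
  obtain ⟨h, hd⟩ := hder z hz
  have h1 := hasFDerivAt_snd.comp z (e.hasFDerivAt_symm hz.1.1 hd)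
  refine h1.congr_fderiv ?_
  have hgz : g z = -(P z / Q z) := by
    simp only [hg, hg₀]
    rw [φ.one_of_mem_closedBall (Metric.ball_subset_closedBall hz.2), one_mul]
  have hQz := (hOU hz).2
  simp only [mem_preimage, mem_compl_iff, mem_singleton_iff] at hQz
  ext
  · simp [shearEquiv, hgz]; field_simp
  · simp [shearEquiv]; field_simp

/-- A nowhere zero smooth one-form on an open set of a plane has local integrating factors. -/
theorem exists_integratingFactor {F : Type*} [NormedAddCommGroup F] [NormedSpace ℝ F]
    [FiniteDimensional ℝ F] (hF : Module.finrank ℝ F = 2) {θ : F → F →L[ℝ] ℝ} {U : Set F}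
    (hU : IsOpen U) (hθ : ContDiffOn ℝ ∞ θ U) {z₀ : F} (hz₀ : z₀ ∈ U) (hθ₀ : θ z₀ ≠ 0) :
    ∃ O ⊆ U, IsOpen O ∧ z₀ ∈ O ∧ ∃ β k : F → ℝ, ContDiffOn ℝ ∞ β O ∧ ContDiffOn ℝ ∞ k O ∧
      ∀ z ∈ O, k z ≠ 0 ∧ HasFDerivAt β (k z • θ z) z := by
  -- Linear coordinates in which the coefficient of the second differential is nonzero; swapping the
  -- two coordinates suffices.
  obtain ⟨L, hL⟩ : ∃ L : (ℝ × ℝ) ≃L[ℝ] F, θ z₀ (L (0, 1)) ≠ 0 := by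
    let L₀ : (ℝ × ℝ) ≃L[ℝ] F := ContinuousLinearEquiv.ofFinrankEq (by simp [hF])
    by_cases h : θ z₀ (L₀ (0, 1)) = 0
    · refine ⟨(ContinuousLinearEquiv.prodComm ℝ ℝ ℝ).trans L₀, fun h' ↦ hθ₀ ?_⟩
      have h'' : θ z₀ (L₀ (1, 0)) = 0 := by simpa using h'
      ext v
      obtain ⟨⟨s, t⟩, rfl⟩ := L₀.surjective v
      have : ((s, t) : ℝ × ℝ) = s • (1, 0) + t • (0, 1) := by simp
      rw [this, map_add, map_smul, map_smul, map_add, map_smul, map_smul, h, h'']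
      simp
    · exact ⟨L₀, h⟩
  have hL' : ContDiffOn ℝ ∞ L (L ⁻¹' U) := L.contDiff.contDiffOn
  have hθL : ContDiffOn ℝ ∞ (fun z ↦ θ (L z)) (L ⁻¹' U) := hθ.comp hL' fun z hz ↦ hz
  obtain ⟨O, hOU, hO, hzO, β, k, hβ, hk, h⟩ := exists_integratingFactor_prod
    (P := fun z ↦ θ (L z) (L (1, 0))) (Q := fun z ↦ θ (L z) (L (0, 1))) (z₀ := L.symm z₀)
    (hU.preimage L.continuous) (hθL.clm_apply contDiffOn_const) (hθL.clm_apply contDiffOn_const)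
    (by simpa using hz₀) (by simpa using hL)
  refine ⟨L.symm ⁻¹' O, fun z hz ↦ by simpa using hOU hz, hO.preimage L.symm.continuous, hzO,
    fun z ↦ β (L.symm z), fun z ↦ k (L.symm z), hβ.comp L.symm.contDiff.contDiffOn fun z hz ↦ hz,
    hk.comp L.symm.contDiff.contDiffOn fun z hz ↦ hz, fun z hz ↦ ⟨(h _ hz).1, ?_⟩⟩
  refine ((h _ hz).2.comp z L.symm.hasFDerivAt).congr_fderiv ?_
  ext v
  have hv : v = (L.symm v).1 • L (1, 0) + (L.symm v).2 • L (0, 1) := by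
    rw [← map_smul, ← map_smul, ← map_add]
    simp
  simp only [ContinuousLinearEquiv.apply_symm_apply, ContinuousLinearMap.comp_apply,
    smul_apply, add_apply, ContinuousLinearMap.coe_fst',
    ContinuousLinearMap.coe_snd', smul_eq_mul, ContinuousLinearEquiv.coe_coe]
  conv_rhs => rw [hv]
  simp only [map_add, map_smul, smul_eq_mul]
  ring

end

/-! ### Derivatives of sums, and the coordinate frame of the ambient space. -/

section

open Set Filter Topology

section Derivatives

variable {E H M F : Type*} [NormedAddCommGroup E] [NormedSpace ℝ E] [TopologicalSpace H]
  {I : ModelWithCorners ℝ E H} [TopologicalSpace M] [ChartedSpace H M]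
  [NormedAddCommGroup F] [NormedSpace ℝ F]

theorem mvfderiv_congr_of_eventuallyEq {f g : M → F} {p : M} (h : f =ᶠ[𝓝 p] g) :
    mvfderiv I f p = mvfderiv I g p := by
  have h1 := h.mfderiv_eq (I := I) (I' := 𝓘(ℝ, F))
  ext v
  exact congr($h1 v)

theorem mdifferentiableAt_finset_sum {ι : Type*} {f : ι → M → F} {p : M} (s : Finset ι)
    (hf : ∀ i ∈ s, MDifferentiableAt I 𝓘(ℝ, F) (f i) p) :
    MDifferentiableAt I 𝓘(ℝ, F) (fun q ↦ ∑ i ∈ s, f i q) p := by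
  classical
  induction s using Finset.induction_on with
  | empty => simpa using mdifferentiableAt_const
  | insert a s ha ih =>
    simp only [Finset.sum_insert ha]
    exact (hf a (by simp)).add (ih fun i hi ↦ hf i (by simp [hi]))

theorem mvfderiv_finset_sum {ι : Type*} {f : ι → M → F} {p : M} (s : Finset ι)
    (hf : ∀ i ∈ s, MDifferentiableAt I 𝓘(ℝ, F) (f i) p) :
    mvfderiv I (fun q ↦ ∑ i ∈ s, f i q) p = ∑ i ∈ s, mvfderiv I (f i) p := by
  classical
  induction s using Finset.induction_on with
  | empty => simpa using mvfderiv_const (I := I) (0 : F)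
  | insert a s ha ih =>
    simp only [Finset.sum_insert ha]
    rw [mvfderiv_fun_add (hf a (by simp))
      (mdifferentiableAt_finset_sum s fun i hi ↦ hf i (by simp [hi])),
      ih fun i hi ↦ hf i (by simp [hi])]

end Derivatives

section Frame

variable {N : Type*} [TopologicalSpace N] [ChartedSpace E4 N] [IsManifold (𝓡 4) ∞ N]

/-- The coordinate frame of the preferred chart at `y₀`. -/
def frameField (y₀ : N) (i : Fin 4) (y : N) : TangentSpace (𝓡 4) y :=
  (trivializationAt E4 (fun y : N ↦ TangentSpace (𝓡 4) y) y₀).symmL ℝ y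
    (EuclideanSpace.single i 1)

theorem symmL_eq_sum_frameField (y₀ y : N) (c : E4) :
    (trivializationAt E4 (fun y : N ↦ TangentSpace (𝓡 4) y) y₀).symmL ℝ y c
      = ∑ i, c i • frameField y₀ i y := by
  have hc : c = ∑ i, c i • EuclideanSpace.single i (1 : ℝ) := by
    ext j; simp [Finset.sum_apply, Pi.single_apply]
  conv_lhs => rw [hc]
  simp [frameField]

theorem eq_sum_frameField {y₀ y : N}
    (hy : y ∈ (trivializationAt E4 (fun y : N ↦ TangentSpace (𝓡 4) y) y₀).baseSet)
    (v : TangentSpace (𝓡 4) y) :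
    v = ∑ i, (trivializationAt E4 (fun y : N ↦ TangentSpace (𝓡 4) y) y₀ ⟨y, v⟩).2 i
      • frameField y₀ i y := by
  rw [← symmL_eq_sum_frameField, ← Trivialization.continuousLinearMapAt_apply_of_mem (R := ℝ) _ hy,
    Trivialization.symmL_continuousLinearMapAt _ hy]

theorem extend_eventuallyEq_symmL {y₀ : N} (v : TangentSpace (𝓡 4) y₀) :
    ∀ᶠ y in 𝓝 y₀, FiberBundle.extend E4 v y
      = (trivializationAt E4 (fun y : N ↦ TangentSpace (𝓡 4) y) y₀).symmL ℝ y
        (trivializationAt E4 (fun y : N ↦ TangentSpace (𝓡 4) y) y₀ ⟨y₀, v⟩).2 := by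
  set t := trivializationAt E4 (fun y : N ↦ TangentSpace (𝓡 4) y) y₀
  filter_upwards [t.open_baseSet.mem_nhds (FiberBundle.mem_baseSet_trivializationAt' y₀)] with y hy
  rw [t.symmL_apply hy]
  rfl

theorem extend_frameField_eventuallyEq (y₀ : N) (i : Fin 4) :
    ∀ᶠ y in 𝓝 y₀, FiberBundle.extend E4 (frameField y₀ i y₀) y = frameField y₀ i y := by
  set t := trivializationAt E4 (fun y : N ↦ TangentSpace (𝓡 4) y) y₀ with ht
  have hy₀ : y₀ ∈ t.baseSet := FiberBundle.mem_baseSet_trivializationAt' y₀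
  filter_upwards [extend_eventuallyEq_symmL (frameField y₀ i y₀)] with y hy
  rw [hy, ← Trivialization.continuousLinearMapAt_apply_of_mem (R := ℝ) _ hy₀, frameField,
    Trivialization.continuousLinearMapAt_symmL _ hy₀]
  rfl

theorem mdifferentiableAt_frameField (y₀ : N) (i : Fin 4) :
    MDifferentiableAt (𝓡 4) ((𝓡 4).prod 𝓘(ℝ, E4))
      (fun y ↦ (⟨y, frameField y₀ i y⟩ : TangentBundle (𝓡 4) N)) y₀ := by
  refine (FiberBundle.mdifferentiableAt_extend (𝓡 4) E4
    (frameField y₀ i y₀)).congr_of_eventuallyEq ?_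
  filter_upwards [extend_frameField_eventuallyEq y₀ i] with y hy
  rw [hy]

variable (conn : CovariantDerivative (𝓡 4) E4 (fun y : N ↦ TangentSpace (𝓡 4) y))

theorem conn_sum_smul {ι : Type*} (s : Finset ι) (c : ι → ℝ)
    (Z : ι → ∀ y : N, TangentSpace (𝓡 4) y) (y₀ : N)
    (hZ : ∀ i, MDifferentiableAt (𝓡 4) ((𝓡 4).prod 𝓘(ℝ, E4))
      (fun y ↦ (⟨y, Z i y⟩ : TangentBundle (𝓡 4) N)) y₀) :
    MDifferentiableAt (𝓡 4) ((𝓡 4).prod 𝓘(ℝ, E4))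
      (fun y ↦ (⟨y, ∑ i ∈ s, c i • Z i y⟩ : TangentBundle (𝓡 4) N)) y₀ ∧
    conn (fun y ↦ ∑ i ∈ s, c i • Z i y) y₀ = ∑ i ∈ s, c i • conn (Z i) y₀ := by
  classical
  have h1 : ∀ i, MDifferentiableAt (𝓡 4) ((𝓡 4).prod 𝓘(ℝ, E4))
      (fun y ↦ (⟨y, (c i • Z i) y⟩ : TangentBundle (𝓡 4) N)) y₀ := fun i ↦
    MDifferentiableAt.smul_const_section (hZ i)
  induction s using Finset.induction_on with
  | empty =>
    simp only [Finset.sum_empty]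
    refine ⟨mdifferentiableAt_zeroSection .., ?_⟩
    exact congr($(conn.zero) y₀)
  | insert a s ha ih =>
    simp only [Finset.sum_insert ha]
    refine ⟨mdifferentiableAt_add_section (h1 a) ih.1, ?_⟩
    have := conn.isCovariantDerivativeOnUniv.add (h1 a) ih.1
    refine this.trans ?_
    rw [ih.2, conn.isCovariantDerivativeOnUniv.smul_const (c a) (hZ a)]

/-- Near the base point the canonical extension has constant components in the coordinate frame, so
no derivative of the components appears. -/
theorem conn_extend_eq_sum {y₀ : N} (v w : TangentSpace (𝓡 4) y₀) :
    conn (FiberBundle.extend E4 v) y₀ w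
      = ∑ i, (trivializationAt E4 (fun y : N ↦ TangentSpace (𝓡 4) y) y₀ ⟨y₀, v⟩).2 i
        • conn (frameField y₀ i) y₀ w := by
  obtain ⟨h1, h2⟩ := conn_sum_smul conn Finset.univ
    (fun i ↦ (trivializationAt E4 (fun y : N ↦ TangentSpace (𝓡 4) y) y₀ ⟨y₀, v⟩).2 i)
    (frameField y₀) y₀ (mdifferentiableAt_frameField y₀)
  rw [conn.isCovariantDerivativeOnUniv.congr_of_eventuallyEq
    (FiberBundle.mdifferentiableAt_extend (𝓡 4) E4 v) h1 univ_mem, h2]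
  · simp
  · filter_upwards [extend_eventuallyEq_symmL v] with y hy
    rw [hy, symmL_eq_sum_frameField]

end Frame

end

/-! ### The covariant derivative along the immersion and its product rule. -/

section

open Set Filter Topology

variable {M : Type*} [TopologicalSpace M] [ChartedSpace E2 M] [IsManifold (𝓡 2) ∞ M]
  {N : Type*} [TopologicalSpace N] [ChartedSpace E4 N] [IsManifold (𝓡 4) ∞ N]
  [RiemannianBundle (fun y : N ↦ TangentSpace (𝓡 4) y)]
  [IsContMDiffRiemannianBundle (𝓡 4) ∞ E4 (fun y : N ↦ TangentSpace (𝓡 4) y)]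
  {ρ : ℝ}

/-- The components, in the coordinate frame at `x p`, of a vector field along `x`. -/
def alongCoord (x : M → N) (p : M) (V : ∀ q : M, TangentSpace (𝓡 4) (x q)) (q : M) : E4 :=
  (trivializationAt E4 (fun y : N ↦ TangentSpace (𝓡 4) y) (x p) ⟨x q, V q⟩).2

theorem mdifferentiableAt_alongCoord {x : M → N} {p : M} {V : ∀ q : M, TangentSpace (𝓡 4) (x q)}
    (hV : MDifferentiableAt (𝓡 2) ((𝓡 4).prod 𝓘(ℝ, E4))
      (fun q ↦ (⟨x q, V q⟩ : TangentBundle (𝓡 4) N)) p) :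
    MDifferentiableAt (𝓡 2) 𝓘(ℝ, E4) (alongCoord x p V) p :=
  ((mdifferentiableAt_totalSpace _ _).1 hV).2

theorem mdifferentiableAt_coord {c : M → E4} {p : M} (hc : MDifferentiableAt (𝓡 2) 𝓘(ℝ, E4) c p)
    (i : Fin 4) : MDifferentiableAt (𝓡 2) 𝓘(ℝ, ℝ) (fun q ↦ c q i) p :=
  ((EuclideanSpace.proj i : E4 →L[ℝ] ℝ).mdifferentiableAt).comp p hc

theorem mvfderiv_coord {c : M → E4} {p : M} (hc : MDifferentiableAt (𝓡 2) 𝓘(ℝ, E4) c p)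
    (i : Fin 4) (v : TangentSpace (𝓡 2) p) :
    mvfderiv (𝓡 2) (fun q ↦ c q i) p v = mvfderiv (𝓡 2) c p v i := by
  have h1 := (EuclideanSpace.proj i : E4 →L[ℝ] ℝ).hasMFDerivAt.comp p hc.hasMFDerivAt
  exact congr($(h1.mfderiv) v)

theorem covAlong_eq_sum (S : ComplexSpaceForm N ρ) (x : M → N)
    (V : ∀ q : M, TangentSpace (𝓡 4) (x q)) (p : M) (v : TangentSpace (𝓡 2) p) :
    covAlong S x V p v
      = ∑ i, mvfderiv (𝓡 2) (alongCoord x p V) p v i • frameField (x p) i (x p)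
        + ∑ i, alongCoord x p V p i
          • S.conn (frameField (x p) i) (x p) (mfderiv (𝓡 2) (𝓡 4) x p v) := by
  rw [covAlong, symmL_eq_sum_frameField, conn_extend_eq_sum]
  rfl

theorem inner_map_sum_smul {y : N} (A : TangentSpace (𝓡 4) y →L[ℝ] TangentSpace (𝓡 4) y)
    (c d : Fin 4 → ℝ) (X Y : Fin 4 → TangentSpace (𝓡 4) y) :
    ⟪A (∑ i, c i • X i), ∑ j, d j • Y j⟫_ℝ = ∑ i, ∑ j, c i * d j * ⟪A (X i), Y j⟫_ℝ := by
  simp only [map_sum, map_smul, sum_inner, inner_sum, real_inner_smul_left, real_inner_smul_right]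
  rw [Finset.sum_comm]
  refine Finset.sum_congr rfl fun i _ ↦ ?_
  exact Finset.sum_congr rfl fun j _ ↦ by ring

/-- Product rule for the covariant derivative along `x` and a bilinear form `⟪A V, W⟫` that is
parallel for the ambient connection. -/
theorem mvfderiv_inner_along (S : ComplexSpaceForm N ρ) {x : M → N} {p : M}
    (hx : MDifferentiableAt (𝓡 2) (𝓡 4) x p)
    {A : ∀ y : N, TangentSpace (𝓡 4) y →L[ℝ] TangentSpace (𝓡 4) y}
    (hA : ∀ Y Z : ∀ y : N, TangentSpace (𝓡 4) y,
      MDifferentiableAt (𝓡 4) ((𝓡 4).prod 𝓘(ℝ, E4))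
        (fun y ↦ (⟨y, Y y⟩ : TangentBundle (𝓡 4) N)) (x p) →
      MDifferentiableAt (𝓡 4) ((𝓡 4).prod 𝓘(ℝ, E4))
        (fun y ↦ (⟨y, Z y⟩ : TangentBundle (𝓡 4) N)) (x p) →
      MDifferentiableAt (𝓡 4) 𝓘(ℝ, ℝ) (fun y ↦ ⟪A y (Y y), Z y⟫_ℝ) (x p) ∧
      ∀ w, mvfderiv (𝓡 4) (fun y ↦ ⟪A y (Y y), Z y⟫_ℝ) (x p) w
        = ⟪A (x p) (S.conn Y (x p) w), Z (x p)⟫_ℝ + ⟪A (x p) (Y (x p)), S.conn Z (x p) w⟫_ℝ)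
    {V W : ∀ q : M, TangentSpace (𝓡 4) (x q)}
    (hV : MDifferentiableAt (𝓡 2) ((𝓡 4).prod 𝓘(ℝ, E4))
      (fun q ↦ (⟨x q, V q⟩ : TangentBundle (𝓡 4) N)) p)
    (hW : MDifferentiableAt (𝓡 2) ((𝓡 4).prod 𝓘(ℝ, E4))
      (fun q ↦ (⟨x q, W q⟩ : TangentBundle (𝓡 4) N)) p) (v : TangentSpace (𝓡 2) p) :
    mvfderiv (𝓡 2) (fun q ↦ ⟪A (x q) (V q), W q⟫_ℝ) p v
      = ⟪A (x p) (covAlong S x V p v), W p⟫_ℝ + ⟪A (x p) (V p), covAlong S x W p v⟫_ℝ := by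
  set G : Fin 4 → Fin 4 → N → ℝ :=
    fun i j y ↦ ⟪A y (frameField (x p) i y), frameField (x p) j y⟫_ℝ with hG
  have hGd := fun i j ↦ hA _ _ (mdifferentiableAt_frameField (x p) i)
    (mdifferentiableAt_frameField (x p) j)
  have hc := mdifferentiableAt_coord (mdifferentiableAt_alongCoord hV)
  have hd := mdifferentiableAt_coord (mdifferentiableAt_alongCoord hW)
  set t := trivializationAt E4 (fun y : N ↦ TangentSpace (𝓡 4) y) (x p) with ht
  have hp : x p ∈ t.baseSet := FiberBundle.mem_baseSet_trivializationAt' (x p)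
  -- In the frame the pairing becomes a sum of products of components with the functions `G i j ∘
  -- x`, so the ordinary product and chain rules apply.
  have hev : (fun q ↦ ⟪A (x q) (V q), W q⟫_ℝ) =ᶠ[𝓝 p] fun q ↦
      ∑ i, ∑ j, alongCoord x p V q i * alongCoord x p W q j * G i j (x q) := by
    filter_upwards [hx.continuousAt.eventually (t.open_baseSet.mem_nhds hp)] with q hq
    conv_lhs => rw [eq_sum_frameField hq (V q), eq_sum_frameField hq (W q), inner_map_sum_smul]
    rfl
  have hGx : ∀ i j, MDifferentiableAt (𝓡 2) 𝓘(ℝ, ℝ) (fun q ↦ G i j (x q)) p := fun i j ↦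
    (hGd i j).1.comp p hx
  have hterm : ∀ i j, MDifferentiableAt (𝓡 2) 𝓘(ℝ, ℝ)
      (fun q ↦ alongCoord x p V q i * alongCoord x p W q j * G i j (x q)) p := fun i j ↦
    ((hc i).mul (hd j)).mul (hGx i j)
  have hdG : ∀ i j, mvfderiv (𝓡 2) (fun q ↦ G i j (x q)) p v =
      ⟪A (x p) (S.conn (frameField (x p) i) (x p) (mfderiv (𝓡 2) (𝓡 4) x p v)),
        frameField (x p) j (x p)⟫_ℝ + ⟪A (x p) (frameField (x p) i (x p)),
        S.conn (frameField (x p) j) (x p) (mfderiv (𝓡 2) (𝓡 4) x p v)⟫_ℝ := fun i j ↦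
    (mvfderiv_comp_apply p (hGd i j).1 hx v).trans ((hGd i j).2 _)
  rw [mvfderiv_congr_of_eventuallyEq hev,
    mvfderiv_finset_sum _ fun i _ ↦ mdifferentiableAt_finset_sum _ fun j _ ↦ hterm i j]
  simp only [mvfderiv_finset_sum _ fun j _ ↦ hterm _ j]
  rw [covAlong_eq_sum, covAlong_eq_sum]
  have hVp : V p = ∑ i, alongCoord x p V p i • frameField (x p) i (x p) :=
    eq_sum_frameField hp (V p)
  have hWp : W p = ∑ i, alongCoord x p W p i • frameField (x p) i (x p) :=
    eq_sum_frameField hp (W p)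
  conv_rhs => rw [hVp, hWp]
  rw [map_add, inner_add_left, inner_add_right]
  simp only [inner_map_sum_smul]
  simp only [← Finset.sum_add_distrib, sum_apply]
  refine Finset.sum_congr rfl fun i _ ↦ Finset.sum_congr rfl fun j _ ↦ ?_
  have hcd : MDifferentiableAt (𝓡 2) 𝓘(ℝ, ℝ)
    (fun q ↦ alongCoord x p V q i * alongCoord x p W q j) p := (hc i).mul (hd j)
  rw [mvfderiv_fun_mul hcd (hGx i j), mvfderiv_fun_mul (hc i) (hd j)]
  simp only [add_apply, smul_apply, smul_eq_mul, hdG,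
    mvfderiv_coord (mdifferentiableAt_alongCoord hV),
    mvfderiv_coord (mdifferentiableAt_alongCoord hW)]
  simp only [hG]
  ring

end

/-! ### Compatibility with metric and complex structure; canonical extensions of tangent vectors. -/

section

open Set Filter Topology

variable {M : Type*} [TopologicalSpace M] [ChartedSpace E2 M] [IsManifold (𝓡 2) ∞ M]
  {N : Type*} [TopologicalSpace N] [ChartedSpace E4 N] [IsManifold (𝓡 4) ∞ N]
  [RiemannianBundle (fun y : N ↦ TangentSpace (𝓡 4) y)]
  [IsContMDiffRiemannianBundle (𝓡 4) ∞ E4 (fun y : N ↦ TangentSpace (𝓡 4) y)]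
  {ρ : ℝ}

theorem mvfderiv_inner_conn (S : ComplexSpaceForm N ρ) {y : N}
    {Y Z : ∀ y : N, TangentSpace (𝓡 4) y}
    (hY : MDifferentiableAt (𝓡 4) ((𝓡 4).prod 𝓘(ℝ, E4))
      (fun y ↦ (⟨y, Y y⟩ : TangentBundle (𝓡 4) N)) y)
    (hZ : MDifferentiableAt (𝓡 4) ((𝓡 4).prod 𝓘(ℝ, E4))
      (fun y ↦ (⟨y, Z y⟩ : TangentBundle (𝓡 4) N)) y) (w : TangentSpace (𝓡 4) y) :
    mvfderiv (𝓡 4) (fun y ↦ ⟪Y y, Z y⟫_ℝ) y w = ⟪S.conn Y y w, Z y⟫_ℝ + ⟪Y y, S.conn Z y w⟫_ℝ := by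
  have := S.metric.mvfderiv_inner_eq (FiberBundle.extend E4 w) hY hZ
  simpa using this

theorem mvfderiv_inner_covAlong (S : ComplexSpaceForm N ρ) {x : M → N} {p : M}
    (hx : MDifferentiableAt (𝓡 2) (𝓡 4) x p) {V W : ∀ q : M, TangentSpace (𝓡 4) (x q)}
    (hV : MDifferentiableAt (𝓡 2) ((𝓡 4).prod 𝓘(ℝ, E4))
      (fun q ↦ (⟨x q, V q⟩ : TangentBundle (𝓡 4) N)) p)
    (hW : MDifferentiableAt (𝓡 2) ((𝓡 4).prod 𝓘(ℝ, E4))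
      (fun q ↦ (⟨x q, W q⟩ : TangentBundle (𝓡 4) N)) p) (v : TangentSpace (𝓡 2) p) :
    mvfderiv (𝓡 2) (fun q ↦ ⟪V q, W q⟫_ℝ) p v
      = ⟪covAlong S x V p v, W p⟫_ℝ + ⟪V p, covAlong S x W p v⟫_ℝ :=
  mvfderiv_inner_along S hx (A := fun y ↦ ContinuousLinearMap.id ℝ (TangentSpace (𝓡 4) y))
    (fun _ _ hY hZ ↦ ⟨hY.inner_bundle hZ, mvfderiv_inner_conn S hY hZ⟩) hV hW v

theorem mdifferentiableAt_J (S : ComplexSpaceForm N ρ) {y : N} {Y : ∀ y : N, TangentSpace (𝓡 4) y}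
    (hY : MDifferentiableAt (𝓡 4) ((𝓡 4).prod 𝓘(ℝ, E4))
      (fun y ↦ (⟨y, Y y⟩ : TangentBundle (𝓡 4) N)) y) :
    MDifferentiableAt (𝓡 4) ((𝓡 4).prod 𝓘(ℝ, E4))
      (fun y ↦ (⟨y, S.J y (Y y)⟩ : TangentBundle (𝓡 4) N)) y :=
  MDifferentiableAt.clm_bundle_apply (F₁ := E4) (F₂ := E4)
    (E₁ := fun y : N ↦ TangentSpace (𝓡 4) y) (E₂ := fun y : N ↦ TangentSpace (𝓡 4) y)
    (S.J_smooth.mdifferentiableAt (by simp)) hY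

theorem mvfderiv_inner_J_covAlong (S : ComplexSpaceForm N ρ) {x : M → N} {p : M}
    (hx : MDifferentiableAt (𝓡 2) (𝓡 4) x p) {V W : ∀ q : M, TangentSpace (𝓡 4) (x q)}
    (hV : MDifferentiableAt (𝓡 2) ((𝓡 4).prod 𝓘(ℝ, E4))
      (fun q ↦ (⟨x q, V q⟩ : TangentBundle (𝓡 4) N)) p)
    (hW : MDifferentiableAt (𝓡 2) ((𝓡 4).prod 𝓘(ℝ, E4))
      (fun q ↦ (⟨x q, W q⟩ : TangentBundle (𝓡 4) N)) p) (v : TangentSpace (𝓡 2) p) :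
    mvfderiv (𝓡 2) (fun q ↦ ⟪S.J (x q) (V q), W q⟫_ℝ) p v
      = ⟪S.J (x p) (covAlong S x V p v), W p⟫_ℝ + ⟪S.J (x p) (V p), covAlong S x W p v⟫_ℝ := by
  refine mvfderiv_inner_along S hx (fun Y Z hY hZ ↦
    ⟨(mdifferentiableAt_J S hY).inner_bundle hZ, fun w ↦ ?_⟩) hV hW v
  rw [mvfderiv_inner_conn S (mdifferentiableAt_J S hY) hZ w, S.J_parallel Y _ hY w]

theorem inner_J_left (S : ComplexSpaceForm N ρ) {y : N} (v w : TangentSpace (𝓡 4) y) :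
    ⟪S.J y v, w⟫_ℝ = -⟪v, S.J y w⟫_ℝ := by
  have := S.J_inner y v (S.J y w)
  rw [S.J_sq, inner_neg_right] at this
  linarith

theorem inner_J_self (S : ComplexSpaceForm N ρ) {y : N} (v : TangentSpace (𝓡 4) y) :
    ⟪S.J y v, v⟫_ℝ = 0 := by
  have := inner_J_left S v v
  have := real_inner_comm v (S.J y v)
  linarith

/-! ### Symmetry of the second fundamental form -/

section Extend

variable {E H M : Type*} [NormedAddCommGroup E] [NormedSpace ℝ E] [TopologicalSpace H]
  {I : ModelWithCorners ℝ E H} [TopologicalSpace M] [ChartedSpace H M] [IsManifold I 1 M]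

/-- The canonical extension of a tangent vector has constant components in the preferred chart. -/
theorem extend_eq_mfderivWithin_symm {p q : M} (hq : q ∈ (chartAt H p).source)
    (w : TangentSpace I p) :
    FiberBundle.extend E w q = mfderivWithin 𝓘(ℝ, E) I (extChartAt I p).symm
      (range I) (extChartAt I p q) (mfderiv I 𝓘(ℝ, E) (extChartAt I p) p w) := by
  set t := trivializationAt E (fun q : M ↦ TangentSpace I q) p with ht
  have hqt : q ∈ t.baseSet := by simpa [ht, TangentBundle.trivializationAt_baseSet] using hq
  have hpt : p ∈ t.baseSet := FiberBundle.mem_baseSet_trivializationAt' p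
  have e1 : FiberBundle.extend E w q = t.symmL ℝ q (t.continuousLinearMapAt ℝ p w) := by
    rw [Trivialization.continuousLinearMapAt_apply_of_mem (R := ℝ) _ hpt, t.symmL_apply hqt]
    rfl
  have e2 : t.continuousLinearMapAt ℝ p w = mfderiv I 𝓘(ℝ, E) (extChartAt I p) p w :=
    DFunLike.congr_fun
      (TangentBundle.continuousLinearMapAt_trivializationAt (mem_chart_source H p)) w
  rw [e1, e2]
  exact DFunLike.congr_fun (TangentBundle.symmL_trivializationAt hq) _

/-- Both fields have constant components in the preferred chart. -/
theorem mlieBracket_extend (p : M) (v w : TangentSpace I p) :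
    VectorField.mlieBracket I (FiberBundle.extend E v) (FiberBundle.extend E w) p = 0 := by
  have key : ∀ u : TangentSpace I p, VectorField.mpullbackWithin 𝓘(ℝ, E) I (extChartAt I p).symm
      (FiberBundle.extend E u) (range I) =ᶠ[𝓝[range I] extChartAt I p p]
      fun _ ↦ mfderiv I 𝓘(ℝ, E) (extChartAt I p) p u := by
    intro u
    filter_upwards [extChartAt_target_mem_nhdsWithin (I := I) p] with z hz
    have hz' : (extChartAt I p).symm z ∈ (chartAt H p).source := by
      simpa using (extChartAt I p).map_target hz
    rw [VectorField.mpullbackWithin_apply, extend_eq_mfderivWithin_symm hz',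
      (extChartAt I p).right_inv hz]
    have hinv := isInvertible_mfderivWithin_extChartAt_symm hz
    exact hinv.inverse_apply_self _
  have h0 : ∀ (c d : E) (s : Set E) (z : E),
      VectorField.lieBracketWithin ℝ (fun _ ↦ c) (fun _ ↦ d) s z = 0 := fun c d s z ↦ by
    simp [VectorField.lieBracketWithin]
  rw [← VectorField.mlieBracketWithin_univ, VectorField.mlieBracketWithin_apply]
  rw [preimage_univ, univ_inter,
    (key v).lieBracketWithin_vectorField_eq_of_mem (key w) (mem_range_self _)]
  exact (congrArg _ (h0 _ _ _ _)).trans (map_zero _)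

end Extend

/-- As the extension is constant in the chart at `p`, differentiating these components once more
gives a pure second derivative of the local expression of `x`. -/
theorem alongCoord_mfderiv_extend (x : M → N) (hx : ContMDiff (𝓡 2) (𝓡 4) ∞ x) (p : M)
    (w : TangentSpace (𝓡 2) p) :
    ∀ᶠ q in 𝓝 p, alongCoord x p
        (fun q ↦ mfderiv (𝓡 2) (𝓡 4) x q (FiberBundle.extend E2 w q)) q
      = fderiv ℝ (writtenInExtChartAt (𝓡 2) (𝓡 4) p x) (extChartAt (𝓡 2) p q)
        (mfderiv (𝓡 2) 𝓘(ℝ, E2) (extChartAt (𝓡 2) p) p w) := by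
  have hmem : ∀ᶠ q in 𝓝 p, q ∈ (chartAt E2 p).source :=
    (chartAt E2 p).open_source.mem_nhds (mem_chart_source E2 p)
  have hmem' : ∀ᶠ q in 𝓝 p, x q ∈ (chartAt E4 (x p)).source :=
    hx.continuous.continuousAt.eventually
      ((chartAt E4 (x p)).open_source.mem_nhds (mem_chart_source E4 (x p)))
  filter_upwards [hmem, hmem'] with q hq hq'
  set t := trivializationAt E4 (fun y : N ↦ TangentSpace (𝓡 4) y) (x p) with ht
  have hqt : x q ∈ t.baseSet := by simpa [ht, TangentBundle.trivializationAt_baseSet] using hq'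
  have hext := extend_eq_mfderivWithin_symm (I := 𝓡 2) hq w
  have h1 : alongCoord x p (fun q ↦ mfderiv (𝓡 2) (𝓡 4) x q (FiberBundle.extend E2 w q)) q
      = mfderiv (𝓡 4) 𝓘(ℝ, E4) (extChartAt (𝓡 4) (x p)) (x q)
        (mfderiv (𝓡 2) (𝓡 4) x q (FiberBundle.extend E2 w q)) := by
    refine Eq.trans ?_ (DFunLike.congr_fun
      (TangentBundle.continuousLinearMapAt_trivializationAt hq') _)
    exact (Trivialization.continuousLinearMapAt_apply_of_mem (R := ℝ) _ hqt _).symm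
  rw [h1, hext]
  have hinv : (extChartAt (𝓡 2) p).symm (extChartAt (𝓡 2) p q) = q :=
    (extChartAt (𝓡 2) p).left_inv (by simpa using hq)
  have hd1 : MDifferentiableWithinAt 𝓘(ℝ, E2) (𝓡 2) (extChartAt (𝓡 2) p).symm (range (𝓡 2))
      (extChartAt (𝓡 2) p q) :=
    mdifferentiableWithinAt_extChartAt_symm ((extChartAt (𝓡 2) p).map_source (by simpa using hq))
  simp only [ModelWithCorners.range_eq_univ, mdifferentiableWithinAt_univ, mfderivWithin_univ] at hd1 ⊢
  have hd2 : MDifferentiableAt (𝓡 2) (𝓡 4) x q := (hx q).mdifferentiableAt (by simp)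
  have hd3 : MDifferentiableAt (𝓡 4) 𝓘(ℝ, E4) (extChartAt (𝓡 4) (x p)) (x q) :=
    mdifferentiableAt_extChartAt hq'
  have hc := (hd3.hasMFDerivAt.comp q hd2.hasMFDerivAt)
  rw [← hinv] at hc
  have hc' := hc.comp _ hd1.hasMFDerivAt
  have h2 : mfderiv 𝓘(ℝ, E2) 𝓘(ℝ, E4) (writtenInExtChartAt (𝓡 2) (𝓡 4) p x)
    (extChartAt (𝓡 2) p q) = _ := hc'.mfderiv
  rw [hinv] at h2
  rw [mfderiv_eq_fderiv] at h2
  exact (DFunLike.congr_fun h2 (mfderiv (𝓡 2) 𝓘(ℝ, E2) (extChartAt (𝓡 2) p) p w)).symm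

end

/-! ### Symmetry and bilinearity of the second fundamental form. -/

section

open Set Filter Topology

variable {M : Type*} [TopologicalSpace M] [ChartedSpace E2 M] [IsManifold (𝓡 2) ∞ M]
  {N : Type*} [TopologicalSpace N] [ChartedSpace E4 N] [IsManifold (𝓡 4) ∞ N]
  [RiemannianBundle (fun y : N ↦ TangentSpace (𝓡 4) y)]
  [IsContMDiffRiemannianBundle (𝓡 4) ∞ E4 (fun y : N ↦ TangentSpace (𝓡 4) y)]
  {ρ : ℝ}

theorem contDiffAt_writtenInExtChartAt {x : M → N} (hx : ContMDiff (𝓡 2) (𝓡 4) ∞ x) (p : M) :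
    ContDiffAt ℝ ∞ (writtenInExtChartAt (𝓡 2) (𝓡 4) p x) (extChartAt (𝓡 2) p p) := by
  have := ((contMDiffAt_iff ..).1 (hx p)).2
  simpa [writtenInExtChartAt, contDiffWithinAt_univ] using this

theorem mvfderiv_alongCoord_mfderiv_extend {x : M → N} (hx : ContMDiff (𝓡 2) (𝓡 4) ∞ x) (p : M)
    (v w : TangentSpace (𝓡 2) p) :
    mvfderiv (𝓡 2) (alongCoord x p
        (fun q ↦ mfderiv (𝓡 2) (𝓡 4) x q (FiberBundle.extend E2 w q))) p v
      = fderiv ℝ (fderiv ℝ (writtenInExtChartAt (𝓡 2) (𝓡 4) p x)) (extChartAt (𝓡 2) p p)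
        (mfderiv (𝓡 2) 𝓘(ℝ, E2) (extChartAt (𝓡 2) p) p v)
        (mfderiv (𝓡 2) 𝓘(ℝ, E2) (extChartAt (𝓡 2) p) p w) := by
  set F := writtenInExtChartAt (𝓡 2) (𝓡 4) p x with hF
  set c : E2 := mfderiv (𝓡 2) 𝓘(ℝ, E2) (extChartAt (𝓡 2) p) p w with hc
  have hFs : ContDiffAt ℝ ∞ F (extChartAt (𝓡 2) p p) := contDiffAt_writtenInExtChartAt hx p
  have hd : DifferentiableAt ℝ (fderiv ℝ F) (extChartAt (𝓡 2) p p) :=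
    (hFs.fderiv_right (m := 1) (by norm_cast)).differentiableAt (by simp)
  have hg : HasFDerivAt (fun z ↦ fderiv ℝ F z c)
      ((fderiv ℝ (fderiv ℝ F) (extChartAt (𝓡 2) p p)).flip c) (extChartAt (𝓡 2) p p) := by
    exact ((ContinuousLinearMap.apply ℝ E4 c).hasFDerivAt).comp _ hd.hasFDerivAt
  have hm := hg.hasMFDerivAt.comp p
    (mdifferentiableAt_extChartAt (I := 𝓡 2) (mem_chart_source E2 p)).hasMFDerivAt
  rw [mvfderiv_congr_of_eventuallyEq (alongCoord_mfderiv_extend x hx p w)]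
  exact DFunLike.congr_fun hm.mfderiv v

/-- The torsion vanishes, and so does the bracket of canonical extensions. -/
theorem conn_extend_symm (S : ComplexSpaceForm N ρ) {y : N} (v w : TangentSpace (𝓡 4) y) :
    S.conn (FiberBundle.extend E4 w) y v = S.conn (FiberBundle.extend E4 v) y w := by
  have h := S.conn.torsion_apply_eq_extend (x := y) v w
  rw [S.torsion_eq_zero, mlieBracket_extend] at h
  simp only [FiberBundle.extend_apply_self] at h
  have h' : (0 : TangentSpace (𝓡 4) y) = _ := h
  rw [sub_zero, eq_comm, sub_eq_zero] at h'
  exact h'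

/-- The component part is a second derivative, symmetric by Schwarz; the connection part is
symmetric by vanishing torsion. -/
theorem covAlong_mfderiv_extend_symm (S : ComplexSpaceForm N ρ) {x : M → N}
    (hx : ContMDiff (𝓡 2) (𝓡 4) ∞ x) (p : M) (v w : TangentSpace (𝓡 2) p) :
    covAlong S x (fun q ↦ mfderiv (𝓡 2) (𝓡 4) x q (FiberBundle.extend E2 w q)) p v
      = covAlong S x (fun q ↦ mfderiv (𝓡 2) (𝓡 4) x q (FiberBundle.extend E2 v q)) p w := by
  have h1 := mvfderiv_alongCoord_mfderiv_extend hx p v w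
  have h2 := mvfderiv_alongCoord_mfderiv_extend hx p w v
  have h3 : mvfderiv (𝓡 2) (alongCoord x p
        (fun q ↦ mfderiv (𝓡 2) (𝓡 4) x q (FiberBundle.extend E2 w q))) p v = 
      mvfderiv (𝓡 2) (alongCoord x p
        (fun q ↦ mfderiv (𝓡 2) (𝓡 4) x q (FiberBundle.extend E2 v q))) p w := by
    rw [h1, h2]
    exact ((contDiffAt_writtenInExtChartAt hx p).isSymmSndFDerivAt (by simp; norm_cast)).eq _ _
  unfold covAlong
  congr 1
  · exact congrArg _ h3
  · simp only [FiberBundle.extend_apply_self]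
    exact conn_extend_symm S _ _

theorem covAlong_add (S : ComplexSpaceForm N ρ) (x : M → N)
    (V : ∀ q : M, TangentSpace (𝓡 4) (x q)) (p : M) (v w : TangentSpace (𝓡 2) p) :
    covAlong S x V p (v + w) = covAlong S x V p v + covAlong S x V p w := by
  simp only [covAlong, map_add]
  abel

theorem covAlong_smul (S : ComplexSpaceForm N ρ) (x : M → N)
    (V : ∀ q : M, TangentSpace (𝓡 4) (x q)) (p : M) (c : ℝ) (v : TangentSpace (𝓡 2) p) :
    covAlong S x V p (c • v) = c • covAlong S x V p v := by
  simp only [covAlong, map_smul, smul_add]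

instance (y : N) : FiniteDimensional ℝ (TangentSpace (𝓡 4) y) :=
  inferInstanceAs (FiniteDimensional ℝ E4)

theorem normalPart_add (x : M → N) (p : M) (u w : TangentSpace (𝓡 4) (x p)) :
    normalPart x p (u + w) = normalPart x p u + normalPart x p w := by
  simp only [normalPart, map_add]
  abel

theorem normalPart_smul (x : M → N) (p : M) (c : ℝ) (w : TangentSpace (𝓡 4) (x p)) :
    normalPart x p (c • w) = c • normalPart x p w := by
  simp only [normalPart, map_smul, smul_sub]

theorem inner_normalPart_mfderiv (x : M → N) (p : M) (w : TangentSpace (𝓡 4) (x p))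
    (v : TangentSpace (𝓡 2) p) :
    ⟪normalPart x p w, mfderiv (𝓡 2) (𝓡 4) x p v⟫_ℝ = 0 := by
  have h := Submodule.sub_starProjection_mem_orthogonal
    (K := LinearMap.range (mfderiv (𝓡 2) (𝓡 4) x p).toLinearMap) w
  rw [real_inner_comm]
  exact h _ ⟨v, rfl⟩

theorem secondFundamentalForm_symm (S : ComplexSpaceForm N ρ) {x : M → N}
    (hx : ContMDiff (𝓡 2) (𝓡 4) ∞ x) (p : M) (v w : TangentSpace (𝓡 2) p) :
    secondFundamentalForm S x p v w = secondFundamentalForm S x p w v := by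
  rw [secondFundamentalForm, secondFundamentalForm, covAlong_mfderiv_extend_symm S hx p v w]

theorem secondFundamentalForm_add_left (S : ComplexSpaceForm N ρ) (x : M → N) (p : M)
    (u v w : TangentSpace (𝓡 2) p) : secondFundamentalForm S x p (u + v) w
      = secondFundamentalForm S x p u w + secondFundamentalForm S x p v w := by
  simp only [secondFundamentalForm, covAlong_add, normalPart_add]

theorem secondFundamentalForm_smul_left (S : ComplexSpaceForm N ρ) (x : M → N) (p : M)
    (c : ℝ) (v w : TangentSpace (𝓡 2) p) : secondFundamentalForm S x p (c • v) w
      = c • secondFundamentalForm S x p v w := by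
  simp only [secondFundamentalForm, covAlong_smul, normalPart_smul]

/-- The definition differentiates an extension of the second argument; its linearity there is
inherited from the first slot by symmetry. -/
theorem secondFundamentalForm_add_right (S : ComplexSpaceForm N ρ) {x : M → N}
    (hx : ContMDiff (𝓡 2) (𝓡 4) ∞ x) (p : M)
    (u v w : TangentSpace (𝓡 2) p) : secondFundamentalForm S x p w (u + v)
      = secondFundamentalForm S x p w u + secondFundamentalForm S x p w v := by
  simp only [secondFundamentalForm_symm S hx p w, secondFundamentalForm_add_left]

theorem secondFundamentalForm_smul_right (S : ComplexSpaceForm N ρ) {x : M → N}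
    (hx : ContMDiff (𝓡 2) (𝓡 4) ∞ x) (p : M)
    (c : ℝ) (v w : TangentSpace (𝓡 2) p) : secondFundamentalForm S x p w (c • v)
      = c • secondFundamentalForm S x p w v := by
  simp only [secondFundamentalForm_symm S hx p w, secondFundamentalForm_smul_left]

end

/-! ### Oriented orthonormal bases, Kähler angle, and adapted frames. -/

section

open Set Filter Topology

variable {M : Type*} [TopologicalSpace M] [ChartedSpace E2 M] [IsManifold (𝓡 2) ∞ M]
  [RiemannianBundle (fun p : M ↦ TangentSpace (𝓡 2) p)]
  [IsContMDiffRiemannianBundle (𝓡 2) ∞ E2 (fun p : M ↦ TangentSpace (𝓡 2) p)]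
  {N : Type*} [TopologicalSpace N] [ChartedSpace E4 N] [IsManifold (𝓡 4) ∞ N]
  [RiemannianBundle (fun y : N ↦ TangentSpace (𝓡 4) y)]
  [IsContMDiffRiemannianBundle (𝓡 4) ∞ E4 (fun y : N ↦ TangentSpace (𝓡 4) y)]
  {ρ : ℝ}

/-! ### Positively oriented orthonormal bases -/

theorem finrank_tangentSpace_surface (p : M) : Module.finrank ℝ (TangentSpace (𝓡 2) p) = 2 := by
  change Module.finrank ℝ E2 = 2
  simp

theorem finrank_tangentSpace_ambient (y : N) : Module.finrank ℝ (TangentSpace (𝓡 4) y) = 4 := by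
  change Module.finrank ℝ E4 = 4
  simp

theorem inner_rot_left (o : SurfaceOrientation M) {p : M} (v w : TangentSpace (𝓡 2) p) :
    ⟪o.rot p v, w⟫_ℝ = -⟪v, o.rot p w⟫_ℝ := by
  have := o.rot_inner p v (o.rot p w)
  rw [o.rot_sq, inner_neg_right] at this
  linarith

theorem inner_rot_self (o : SurfaceOrientation M) {p : M} (v : TangentSpace (𝓡 2) p) :
    ⟪o.rot p v, v⟫_ℝ = 0 := by
  have := inner_rot_left o v v
  have := real_inner_comm v (o.rot p v)
  linarith

theorem inner_self_rot (o : SurfaceOrientation M) {p : M} (v : TangentSpace (𝓡 2) p) :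
    ⟪v, o.rot p v⟫_ℝ = 0 := by
  rw [real_inner_comm, inner_rot_self]

theorem inner_self_of_norm_eq_one {p : M} {e : TangentSpace (𝓡 2) p} (he : ‖e‖ = 1) :
    ⟪e, e⟫_ℝ = 1 := by
  rw [real_inner_self_eq_norm_sq, he, one_pow]

theorem inner_rot_rot_self (o : SurfaceOrientation M) {p : M} {e : TangentSpace (𝓡 2) p}
    (he : ‖e‖ = 1) : ⟪o.rot p e, o.rot p e⟫_ℝ = 1 := by
  rw [o.rot_inner, inner_self_of_norm_eq_one he]

theorem norm_rot (o : SurfaceOrientation M) {p : M} (v : TangentSpace (𝓡 2) p) :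
    ‖o.rot p v‖ = ‖v‖ := by
  rw [norm_eq_sqrt_real_inner, o.rot_inner, ← norm_eq_sqrt_real_inner]

theorem exists_norm_eq_one (p : M) : ∃ e : TangentSpace (𝓡 2) p, ‖e‖ = 1 :=
  ⟨stdOrthonormalBasis ℝ (TangentSpace (𝓡 2) p) ⟨0, by rw [finrank_tangentSpace_surface]; simp⟩,
    (stdOrthonormalBasis ℝ (TangentSpace (𝓡 2) p)).orthonormal.1 _⟩

theorem orthonormal_rot (o : SurfaceOrientation M) {p : M} {e : TangentSpace (𝓡 2) p}
    (he : ‖e‖ = 1) : Orthonormal ℝ ![e, o.rot p e] := by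
  simp [orthonormal_vecCons_iff, he, norm_rot, inner_self_rot]

theorem eq_smul_add_smul_rot (o : SurfaceOrientation M) {p : M} {e : TangentSpace (𝓡 2) p}
    (he : ‖e‖ = 1) (v : TangentSpace (𝓡 2) p) :
    v = ⟪e, v⟫_ℝ • e + ⟪o.rot p e, v⟫_ℝ • o.rot p e := by
  have hs := (orthonormal_rot o he).linearIndependent.span_eq_top_of_card_eq_finrank
    (by rw [finrank_tangentSpace_surface]; simp)
  have := (OrthonormalBasis.mk (orthonormal_rot o he) hs.ge).sum_repr' v
  simpa [Fin.sum_univ_two] using this.symm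

/-! ### The Kähler angle -/

/-- The cosine of the Kähler angle. -/
def kaehlerCos (S : ComplexSpaceForm N ρ) (o : SurfaceOrientation M) (x : M → N) (p : M) : ℝ :=
  (1 / 2 : ℝ) * ∑ i,
    ⟪S.J (x p) (mfderiv (𝓡 2) (𝓡 4) x p (stdOrthonormalBasis ℝ (TangentSpace (𝓡 2) p) i)),
      mfderiv (𝓡 2) (𝓡 4) x p (o.rot p (stdOrthonormalBasis ℝ (TangentSpace (𝓡 2) p) i))⟫_ℝ

theorem kaehlerAngle_eq (S : ComplexSpaceForm N ρ) (o : SurfaceOrientation M) (x : M → N) :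
    kaehlerAngle S o x = fun p ↦ Real.arccos (kaehlerCos S o x p) := rfl

/-- Both sides are skew bilinear forms on a plane, hence proportional; the factor is read off from
one oriented orthonormal basis. -/
theorem inner_J_mfderiv_of_norm_eq_one (S : ComplexSpaceForm N ρ) (o : SurfaceOrientation M)
    (x : M → N) {p : M} {e : TangentSpace (𝓡 2) p} (he : ‖e‖ = 1) (v w : TangentSpace (𝓡 2) p) :
    ⟪S.J (x p) (mfderiv (𝓡 2) (𝓡 4) x p v), mfderiv (𝓡 2) (𝓡 4) x p w⟫_ℝ
      = ⟪S.J (x p) (mfderiv (𝓡 2) (𝓡 4) x p e), mfderiv (𝓡 2) (𝓡 4) x p (o.rot p e)⟫_ℝ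
        * ⟪o.rot p v, w⟫_ℝ := by
  have h1 : ⟪S.J (x p) (mfderiv (𝓡 2) (𝓡 4) x p (o.rot p e)), mfderiv (𝓡 2) (𝓡 4) x p e⟫_ℝ
      = -⟪S.J (x p) (mfderiv (𝓡 2) (𝓡 4) x p e), mfderiv (𝓡 2) (𝓡 4) x p (o.rot p e)⟫_ℝ := by
    rw [inner_J_left, real_inner_comm]
  rw [eq_smul_add_smul_rot o he v, eq_smul_add_smul_rot o he w]
  generalize ⟪e, v⟫_ℝ = a
  generalize ⟪o.rot p e, v⟫_ℝ = b
  generalize ⟪e, w⟫_ℝ = c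
  generalize ⟪o.rot p e, w⟫_ℝ = d
  simp only [map_add, map_smul, inner_add_left, inner_add_right, real_inner_smul_left,
    real_inner_smul_right, inner_J_self, h1, o.rot_sq, inner_neg_left, inner_rot_rot_self o he,
    inner_rot_self, inner_self_rot, inner_self_of_norm_eq_one he]
  ring

theorem kaehlerCos_eq (S : ComplexSpaceForm N ρ) (o : SurfaceOrientation M) (x : M → N) {p : M}
    {e : TangentSpace (𝓡 2) p} (he : ‖e‖ = 1) :
    kaehlerCos S o x p
      = ⟪S.J (x p) (mfderiv (𝓡 2) (𝓡 4) x p e), mfderiv (𝓡 2) (𝓡 4) x p (o.rot p e)⟫_ℝ := by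
  have h : ∀ i, ⟪S.J (x p) (mfderiv (𝓡 2) (𝓡 4) x p
      (stdOrthonormalBasis ℝ (TangentSpace (𝓡 2) p) i)),
      mfderiv (𝓡 2) (𝓡 4) x p (o.rot p (stdOrthonormalBasis ℝ (TangentSpace (𝓡 2) p) i))⟫_ℝ
      = ⟪S.J (x p) (mfderiv (𝓡 2) (𝓡 4) x p e), mfderiv (𝓡 2) (𝓡 4) x p (o.rot p e)⟫_ℝ := by
    intro i
    rw [inner_J_mfderiv_of_norm_eq_one S o x he, inner_rot_rot_self o
      ((stdOrthonormalBasis ℝ (TangentSpace (𝓡 2) p)).orthonormal.1 i), mul_one]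
  rw [kaehlerCos, Finset.sum_congr rfl fun i _ ↦ h i]
  simp [finrank_tangentSpace_surface]

theorem inner_J_mfderiv (S : ComplexSpaceForm N ρ) (o : SurfaceOrientation M) (x : M → N) {p : M}
    (v w : TangentSpace (𝓡 2) p) :
    ⟪S.J (x p) (mfderiv (𝓡 2) (𝓡 4) x p v), mfderiv (𝓡 2) (𝓡 4) x p w⟫_ℝ
      = kaehlerCos S o x p * ⟪o.rot p v, w⟫_ℝ := by
  obtain ⟨e, he⟩ := exists_norm_eq_one p
  rw [inner_J_mfderiv_of_norm_eq_one S o x he, kaehlerCos_eq S o x he]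

theorem IsIsometricImmersion.norm_mfderiv {x : M → N} (hx : IsIsometricImmersion x) {p : M}
    (v : TangentSpace (𝓡 2) p) : ‖mfderiv (𝓡 2) (𝓡 4) x p v‖ = ‖v‖ := by
  rw [norm_eq_sqrt_real_inner, hx.isometric, ← norm_eq_sqrt_real_inner]

theorem norm_J (S : ComplexSpaceForm N ρ) {y : N} (v : TangentSpace (𝓡 4) y) :
    ‖S.J y v‖ = ‖v‖ := by
  rw [norm_eq_sqrt_real_inner, S.J_inner, ← norm_eq_sqrt_real_inner]

theorem abs_kaehlerCos_le_one (S : ComplexSpaceForm N ρ) (o : SurfaceOrientation M) {x : M → N}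
    (hx : IsIsometricImmersion x) (p : M) : |kaehlerCos S o x p| ≤ 1 := by
  obtain ⟨e, he⟩ := exists_norm_eq_one p
  rw [kaehlerCos_eq S o x he]
  refine (abs_real_inner_le_norm _ _).trans ?_
  rw [norm_J, hx.norm_mfderiv, hx.norm_mfderiv, norm_rot, he, one_mul]

theorem cos_kaehlerAngle (S : ComplexSpaceForm N ρ) (o : SurfaceOrientation M) {x : M → N}
    (hx : IsIsometricImmersion x) (p : M) :
    Real.cos (kaehlerAngle S o x p) = kaehlerCos S o x p := by
  have h := abs_le.1 (abs_kaehlerCos_le_one S o hx p)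
  exact Real.cos_arccos h.1 h.2

/-- A trace does not depend on the orthonormal basis; the coefficients are summed by Parseval. -/
theorem meanCurvature_eq_of_norm_eq_one (S : ComplexSpaceForm N ρ) (o : SurfaceOrientation M) {x : M → N}
    (hx : IsIsometricImmersion x) {p : M} {e : TangentSpace (𝓡 2) p} (he : ‖e‖ = 1) :
    meanCurvature S x p = (1 / 2 : ℝ) • (secondFundamentalForm S x p e e
      + secondFundamentalForm S x p (o.rot p e) (o.rot p e)) := by
  set b := stdOrthonormalBasis ℝ (TangentSpace (𝓡 2) p)
  have h1 : ∀ v w : TangentSpace (𝓡 2) p, ∑ i, ⟪v, b i⟫_ℝ * ⟪w, b i⟫_ℝ = ⟪v, w⟫_ℝ := by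
    intro v w
    rw [← b.sum_inner_mul_inner v w]
    exact Finset.sum_congr rfl fun i _ ↦ by rw [real_inner_comm w]
  have h2 : ∀ i, secondFundamentalForm S x p (b i) (b i)
      = (⟪e, b i⟫_ℝ * ⟪e, b i⟫_ℝ) • secondFundamentalForm S x p e e
        + (⟪e, b i⟫_ℝ * ⟪o.rot p e, b i⟫_ℝ) • (2 : ℝ) • secondFundamentalForm S x p e (o.rot p e)
        + (⟪o.rot p e, b i⟫_ℝ * ⟪o.rot p e, b i⟫_ℝ)
          • secondFundamentalForm S x p (o.rot p e) (o.rot p e) := by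
    intro i
    rw [eq_smul_add_smul_rot o he (b i)]
    generalize ⟪e, b i⟫_ℝ = c
    generalize ⟪o.rot p e, b i⟫_ℝ = d
    simp only [inner_add_right, real_inner_smul_right, inner_self_rot, inner_rot_self,
      inner_rot_rot_self o he, inner_self_of_norm_eq_one he, secondFundamentalForm_add_left,
      secondFundamentalForm_smul_left, secondFundamentalForm_add_right S hx.smooth,
      secondFundamentalForm_smul_right S hx.smooth,
      secondFundamentalForm_symm S hx.smooth p (o.rot p e) e]
    module
  rw [meanCurvature, Finset.sum_congr rfl fun i _ ↦ h2 i]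
  simp only [Finset.sum_add_distrib, ← Finset.sum_smul, h1, inner_self_rot,
    inner_rot_rot_self o he, inner_self_of_norm_eq_one he]
  simp

/-! ### Normal vectors -/

section Normal

variable (S : ComplexSpaceForm N ρ) (o : SurfaceOrientation M) {x : M → N}

theorem inner_normalVec3_mfderiv (hx : IsIsometricImmersion x) {p : M}
    (e v : TangentSpace (𝓡 2) p) :
    ⟪normalVec3 S o x e (o.rot p e), mfderiv (𝓡 2) (𝓡 4) x p v⟫_ℝ = 0 := by
  rw [normalVec3, real_inner_smul_left, inner_add_left, real_inner_smul_left, hx.isometric,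
    inner_J_mfderiv S o, cos_kaehlerAngle S o hx, o.rot_sq, inner_neg_left]
  ring

theorem inner_normalVec4_mfderiv (hx : IsIsometricImmersion x) {p : M}
    (e v : TangentSpace (𝓡 2) p) :
    ⟪normalVec4 S o x e (o.rot p e), mfderiv (𝓡 2) (𝓡 4) x p v⟫_ℝ = 0 := by
  rw [normalVec4, real_inner_smul_left, inner_sub_left, real_inner_smul_left, hx.isometric,
    inner_J_mfderiv S o, cos_kaehlerAngle S o hx]
  ring

theorem inner_mfderiv_J (p : M) (v w : TangentSpace (𝓡 2) p) :
    ⟪mfderiv (𝓡 2) (𝓡 4) x p v, S.J (x p) (mfderiv (𝓡 2) (𝓡 4) x p w)⟫_ℝ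
      = kaehlerCos S o x p * ⟪o.rot p w, v⟫_ℝ := by
  rw [real_inner_comm, inner_J_mfderiv S o]

theorem inner_normalVec3_self (hx : IsIsometricImmersion x) {p : M}
    (hp : Real.sin (kaehlerAngle S o x p) ≠ 0) {e : TangentSpace (𝓡 2) p} (he : ‖e‖ = 1) :
    ⟪normalVec3 S o x e (o.rot p e), normalVec3 S o x e (o.rot p e)⟫_ℝ = 1 := by
  have hs := Real.sin_sq_add_cos_sq (kaehlerAngle S o x p)
  simp only [normalVec3, real_inner_smul_left, real_inner_smul_right, inner_add_left,
    inner_add_right, S.J_inner, hx.isometric, inner_J_mfderiv S o, inner_mfderiv_J S o,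
    o.rot_sq, inner_neg_left, inner_rot_rot_self o he, inner_self_of_norm_eq_one he]
  rw [← cos_kaehlerAngle S o hx]
  field_simp
  linear_combination -hs

theorem inner_normalVec4_self (hx : IsIsometricImmersion x) {p : M}
    (hp : Real.sin (kaehlerAngle S o x p) ≠ 0) {e : TangentSpace (𝓡 2) p} (he : ‖e‖ = 1) :
    ⟪normalVec4 S o x e (o.rot p e), normalVec4 S o x e (o.rot p e)⟫_ℝ = 1 := by
  have hs := Real.sin_sq_add_cos_sq (kaehlerAngle S o x p)
  simp only [normalVec4, real_inner_smul_left, real_inner_smul_right, inner_sub_left,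
    inner_sub_right, S.J_inner, hx.isometric, inner_J_mfderiv S o, inner_mfderiv_J S o,
    inner_rot_rot_self o he, inner_self_of_norm_eq_one he]
  rw [← cos_kaehlerAngle S o hx]
  field_simp
  linear_combination -hs

theorem inner_normalVec3_normalVec4 (hx : IsIsometricImmersion x) {p : M}
    (e : TangentSpace (𝓡 2) p) :
    ⟪normalVec3 S o x e (o.rot p e), normalVec4 S o x e (o.rot p e)⟫_ℝ = 0 := by
  simp only [normalVec3, normalVec4, real_inner_smul_left, real_inner_smul_right, inner_add_left,
    inner_sub_right, S.J_inner, hx.isometric, inner_J_mfderiv S o, inner_mfderiv_J S o,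
    inner_rot_self, inner_self_rot, o.rot_sq, inner_neg_left]
  ring

theorem eq_smul_normalVec3_add_smul_normalVec4 (hx : IsIsometricImmersion x) {p : M}
    (hp : Real.sin (kaehlerAngle S o x p) ≠ 0) {e : TangentSpace (𝓡 2) p} (he : ‖e‖ = 1)
    {w : TangentSpace (𝓡 4) (x p)} (hw : ∀ v, ⟪w, mfderiv (𝓡 2) (𝓡 4) x p v⟫_ℝ = 0) :
    w = ⟪normalVec3 S o x e (o.rot p e), w⟫_ℝ • normalVec3 S o x e (o.rot p e)
      + ⟪normalVec4 S o x e (o.rot p e), w⟫_ℝ • normalVec4 S o x e (o.rot p e) := by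
  have h3 : ∀ v, ⟪mfderiv (𝓡 2) (𝓡 4) x p v, normalVec3 S o x e (o.rot p e)⟫_ℝ = 0 := fun v ↦ by
    rw [real_inner_comm, inner_normalVec3_mfderiv S o hx]
  have h4 : ∀ v, ⟪mfderiv (𝓡 2) (𝓡 4) x p v, normalVec4 S o x e (o.rot p e)⟫_ℝ = 0 := fun v ↦ by
    rw [real_inner_comm, inner_normalVec4_mfderiv S o hx]
  have n3 : ‖normalVec3 S o x e (o.rot p e)‖ = 1 := by
    rw [norm_eq_sqrt_real_inner, inner_normalVec3_self S o hx hp he, Real.sqrt_one]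
  have n4 : ‖normalVec4 S o x e (o.rot p e)‖ = 1 := by
    rw [norm_eq_sqrt_real_inner, inner_normalVec4_self S o hx hp he, Real.sqrt_one]
  have ho : Orthonormal ℝ ![mfderiv (𝓡 2) (𝓡 4) x p e, mfderiv (𝓡 2) (𝓡 4) x p (o.rot p e),
      normalVec3 S o x e (o.rot p e), normalVec4 S o x e (o.rot p e)] := by
    simp [orthonormal_vecCons_iff, Fin.forall_fin_succ, he, norm_rot, hx.norm_mfderiv,
      hx.isometric, inner_self_rot, h3, h4, n3, n4, inner_normalVec3_normalVec4 S o hx]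
  have hs := ho.linearIndependent.span_eq_top_of_card_eq_finrank
    (by rw [finrank_tangentSpace_ambient]; simp)
  have := (OrthonormalBasis.mk ho hs.ge).sum_repr' w
  have hw' : ∀ v, ⟪mfderiv (𝓡 2) (𝓡 4) x p v, w⟫_ℝ = 0 := fun v ↦ by rw [real_inner_comm, hw]
  simpa [Fin.sum_univ_four, hw'] using this.symm

theorem inner_meanCurvature_mfderiv (p : M) (v : TangentSpace (𝓡 2) p) :
    ⟪meanCurvature S x p, mfderiv (𝓡 2) (𝓡 4) x p v⟫_ℝ = 0 := by
  rw [meanCurvature, real_inner_smul_left, sum_inner]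
  simp [secondFundamentalForm, inner_normalPart_mfderiv]

/-- Turning the tangent basis turns (e₃, e₄) by the same amount, so e₃ can be pointed in any normal
direction. -/
theorem normalVec3_rotate {p : M} (e : TangentSpace (𝓡 2) p) (c d : ℝ) :
    normalVec3 S o x (c • e + d • o.rot p e) (o.rot p (c • e + d • o.rot p e))
      = c • normalVec3 S o x e (o.rot p e) + d • normalVec4 S o x e (o.rot p e) := by
  simp only [normalVec3, normalVec4, map_add, map_smul, o.rot_sq, map_neg]
  module

theorem nonempty_adaptedFrame (hx : IsIsometricImmersion x) {p : M}
    (hp : Real.sin (kaehlerAngle S o x p) ≠ 0) (hH : meanCurvature S x p ≠ 0) :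
    Nonempty (AdaptedFrame S o x p) := by
  obtain ⟨e, he⟩ := exists_norm_eq_one p
  set H := meanCurvature S x p with hHdef
  have hH' : ‖H‖ ≠ 0 := norm_ne_zero_iff.2 hH
  have hn := eq_smul_normalVec3_add_smul_normalVec4 S o hx hp he (inner_meanCurvature_mfderiv S p)
  rw [← hHdef] at hn
  set c := ⟪normalVec3 S o x e (o.rot p e), H⟫_ℝ
  set d := ⟪normalVec4 S o x e (o.rot p e), H⟫_ℝ
  have hcd : c ^ 2 + d ^ 2 = ‖H‖ ^ 2 := by
    have h1 : ⟪H, H⟫_ℝ = ⟪c • normalVec3 S o x e (o.rot p e) + d • normalVec4 S o x e (o.rot p e),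
      c • normalVec3 S o x e (o.rot p e) + d • normalVec4 S o x e (o.rot p e)⟫_ℝ := by rw [← hn]
    have h34 := inner_normalVec3_normalVec4 S o hx e
    have h43 := h34
    rw [real_inner_comm] at h43
    simp only [inner_add_left, inner_add_right, real_inner_smul_left, real_inner_smul_right,
      inner_normalVec3_self S o hx hp he, inner_normalVec4_self S o hx hp he, h34, h43] at h1
    rw [← real_inner_self_eq_norm_sq, h1]
    ring
  -- For H = c e₃ + d e₄ this rotation makes the new e₃ equal to -H/|H|.
  refine ⟨⟨(-c / ‖H‖) • e + (-d / ‖H‖) • o.rot p e, _, ?_, rfl, ?_⟩⟩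
  · have : ‖(-c / ‖H‖) • e + (-d / ‖H‖) • o.rot p e‖ ^ 2 = 1 := by
      rw [← real_inner_self_eq_norm_sq]
      simp only [inner_add_left, inner_add_right, real_inner_smul_left, real_inner_smul_right,
        inner_rot_rot_self o he, inner_self_of_norm_eq_one he, inner_rot_self, inner_self_rot]
      field_simp
      linear_combination hcd
    exact (pow_eq_one_iff_of_nonneg (norm_nonneg _) two_ne_zero).1 this
  · rw [normalVec3_rotate, ← hHdef, smul_add, smul_smul, smul_smul]
    conv_lhs => rw [hn]
    congr 2 <;> field_simp

end Normal

end

/-! ### The differential of the cosine of the Kähler angle. -/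

section

open Set Filter Topology

variable {M : Type*} [TopologicalSpace M] [ChartedSpace E2 M] [IsManifold (𝓡 2) ∞ M]
  [RiemannianBundle (fun p : M ↦ TangentSpace (𝓡 2) p)]
  [IsContMDiffRiemannianBundle (𝓡 2) ∞ E2 (fun p : M ↦ TangentSpace (𝓡 2) p)]
  {N : Type*} [TopologicalSpace N] [ChartedSpace E4 N] [IsManifold (𝓡 4) ∞ N]
  [RiemannianBundle (fun y : N ↦ TangentSpace (𝓡 4) y)]
  [IsContMDiffRiemannianBundle (𝓡 4) ∞ E4 (fun y : N ↦ TangentSpace (𝓡 4) y)]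
  {ρ : ℝ}

/-! ### Smoothness and derivative of the cosine of the Kähler angle -/

theorem contMDiffAt_mfderiv_extend {x : M → N} (hx : ContMDiff (𝓡 2) (𝓡 4) ∞ x) (p : M)
    (w : TangentSpace (𝓡 2) p) :
    ContMDiffAt (𝓡 2) ((𝓡 4).prod 𝓘(ℝ, E4)) ∞
      (fun q ↦ (⟨x q, mfderiv (𝓡 2) (𝓡 4) x q (FiberBundle.extend E2 w q)⟩ :
        TangentBundle (𝓡 4) N)) p := by
  have h1 : ContMDiff (𝓡 2).tangent (𝓡 4).tangent ∞ (tangentMap (𝓡 2) (𝓡 4) x) :=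
    hx.contMDiff_tangentMap (by norm_cast)
  exact h1.contMDiffAt.comp p (FiberBundle.contMDiffAt_extend (𝓡 2) E2 w)

theorem contMDiffAt_inner_J_mfderiv_extend (S : ComplexSpaceForm N ρ) {x : M → N}
    (hx : ContMDiff (𝓡 2) (𝓡 4) ∞ x) (p : M) (v w : TangentSpace (𝓡 2) p) :
    ContMDiffAt (𝓡 2) 𝓘(ℝ, ℝ) ∞ (fun q ↦
      ⟪S.J (x q) (mfderiv (𝓡 2) (𝓡 4) x q (FiberBundle.extend E2 v q)),
        mfderiv (𝓡 2) (𝓡 4) x q (FiberBundle.extend E2 w q)⟫_ℝ) p := by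
  have hJ := (S.J_smooth.comp hx).contMDiffAt (x := p)
  have h1 := ContMDiffAt.clm_bundle_apply (F₁ := E4) (F₂ := E4)
    (E₁ := fun y : N ↦ TangentSpace (𝓡 4) y) (E₂ := fun y : N ↦ TangentSpace (𝓡 4) y)
    hJ (contMDiffAt_mfderiv_extend hx p v)
  exact h1.inner_bundle (contMDiffAt_mfderiv_extend hx p w)

theorem contMDiffAt_inner_rot_extend (o : SurfaceOrientation M) (p : M)
    (v w : TangentSpace (𝓡 2) p) :
    ContMDiffAt (𝓡 2) 𝓘(ℝ, ℝ) ∞ (fun q ↦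
      ⟪o.rot q (FiberBundle.extend E2 v q), FiberBundle.extend E2 w q⟫_ℝ) p := by
  have h1 := ContMDiffAt.clm_bundle_apply (F₁ := E2) (F₂ := E2)
    (E₁ := fun y : M ↦ TangentSpace (𝓡 2) y) (E₂ := fun y : M ↦ TangentSpace (𝓡 2) y)
    (o.rot_smooth.contMDiffAt (x := p)) (FiberBundle.contMDiffAt_extend (𝓡 2) E2 v)
  exact h1.inner_bundle (FiberBundle.contMDiffAt_extend (𝓡 2) E2 w)

/-- The standard orthonormal basis in the definition need not vary smoothly with the point. Locally
cos α is instead the quotient of ⟨J dX, dY⟩ by ⟨rot X, Y⟩ for smooth fields X, Y with nonzero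
denominator. -/
theorem contMDiff_kaehlerCos (S : ComplexSpaceForm N ρ) (o : SurfaceOrientation M) {x : M → N}
    (hx : IsIsometricImmersion x) : ContMDiff (𝓡 2) 𝓘(ℝ, ℝ) ∞ (kaehlerCos S o x) := by
  intro p
  obtain ⟨e, he⟩ := exists_norm_eq_one p
  have hg := contMDiffAt_inner_rot_extend o p e (o.rot p e)
  have hf := contMDiffAt_inner_J_mfderiv_extend S hx.smooth p e (o.rot p e)
  have hg0 : ⟪o.rot p (FiberBundle.extend E2 e p),
      FiberBundle.extend E2 (o.rot p e) p⟫_ℝ ≠ 0 := by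
    simp only [FiberBundle.extend_apply_self]
    rw [inner_rot_rot_self o he]
    exact one_ne_zero
  refine (hf.div₀ hg hg0).congr_of_eventuallyEq ?_
  filter_upwards [hg.continuousAt.eventually_ne hg0] with q hq
  rw [Pi.div_apply, inner_J_mfderiv S o, mul_div_cancel_right₀ _ hq]

/-- It lets ⟨rot X, Y⟩ be differentiated through inner products of X and Y alone, without a
covariant derivative of `rot`. -/
theorem inner_rot_sq (o : SurfaceOrientation M) {p : M} (v w : TangentSpace (𝓡 2) p) :
    ⟪o.rot p v, w⟫_ℝ * ⟪o.rot p v, w⟫_ℝ + ⟪v, w⟫_ℝ * ⟪v, w⟫_ℝ = ⟪v, v⟫_ℝ * ⟪w, w⟫_ℝ := by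
  obtain ⟨e, he⟩ := exists_norm_eq_one p
  rw [eq_smul_add_smul_rot o he v, eq_smul_add_smul_rot o he w]
  generalize ⟪e, v⟫_ℝ = a
  generalize ⟪o.rot p e, v⟫_ℝ = b
  generalize ⟪e, w⟫_ℝ = c
  generalize ⟪o.rot p e, w⟫_ℝ = d
  simp only [map_add, map_smul, inner_add_left, inner_add_right, real_inner_smul_left,
    real_inner_smul_right, o.rot_sq, inner_neg_left, inner_rot_rot_self o he,
    inner_rot_self, inner_self_rot, inner_self_of_norm_eq_one he]
  ring

theorem exists_eq_mfderiv_add_normalPart (x : M → N) (p : M) (w : TangentSpace (𝓡 4) (x p)) :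
    ∃ u, w = mfderiv (𝓡 2) (𝓡 4) x p u + normalPart x p w := by
  obtain ⟨u, hu⟩ := Submodule.starProjection_apply_mem
    (LinearMap.range (mfderiv (𝓡 2) (𝓡 4) x p).toLinearMap) w
  refine ⟨u, ?_⟩
  rw [normalPart, ← hu]
  simp

/-- Differentiating g² + P² = QR at p gives dg = (dQ + dR)/2, because P vanishes there and g = Q = R
= 1. It serves for C = cos α, f = ⟨J dX, dY⟩, g = ⟨rot X, Y⟩, P = ⟨X, Y⟩, Q = |X|², R = |Y|². -/
theorem mvfderiv_eq_of_mul_eq {C g P Q R f : M → ℝ} {p : M}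
    (hC : MDifferentiableAt (𝓡 2) 𝓘(ℝ, ℝ) C p) (hg : MDifferentiableAt (𝓡 2) 𝓘(ℝ, ℝ) g p)
    (hP : MDifferentiableAt (𝓡 2) 𝓘(ℝ, ℝ) P p) (hQ : MDifferentiableAt (𝓡 2) 𝓘(ℝ, ℝ) Q p)
    (hR : MDifferentiableAt (𝓡 2) 𝓘(ℝ, ℝ) R p) (h : ∀ q, g q * g q + P q * P q = Q q * R q)
    (hf : ∀ q, f q = C q * g q) (hgp : g p = 1) (hPp : P p = 0) (hQp : Q p = 1) (hRp : R p = 1)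
    (v : TangentSpace (𝓡 2) p) :
    mvfderiv (𝓡 2) C p v = mvfderiv (𝓡 2) f p v
      - C p * ((mvfderiv (𝓡 2) Q p v + mvfderiv (𝓡 2) R p v) / 2) := by
  have hgg : MDifferentiableAt (𝓡 2) 𝓘(ℝ, ℝ) (fun q ↦ g q * g q) p := hg.mul hg
  have hPP : MDifferentiableAt (𝓡 2) 𝓘(ℝ, ℝ) (fun q ↦ P q * P q) p := hP.mul hP
  have h1 : mvfderiv (𝓡 2) (fun q ↦ g q * g q + P q * P q) p v
      = mvfderiv (𝓡 2) (fun q ↦ Q q * R q) p v := by rw [funext h]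
  rw [mvfderiv_fun_add hgg hPP, mvfderiv_fun_mul hg hg, mvfderiv_fun_mul hP hP,
    mvfderiv_fun_mul hQ hR] at h1
  have h2 : mvfderiv (𝓡 2) f p v = mvfderiv (𝓡 2) (fun q ↦ C q * g q) p v := by rw [funext hf]
  rw [mvfderiv_fun_mul hC hg] at h2
  simp only [add_apply, smul_apply, smul_eq_mul, hgp, hPp, hQp, hRp] at h1 h2
  rw [h2]
  linear_combination (-C p / 2) * h1

/-- The extensions of e and rot e are orthonormal at p only. The derivatives of their lengths cancel
exactly the tangential parts of the covariant derivatives, leaving the second fundamental form. -/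
theorem mvfderiv_kaehlerCos (S : ComplexSpaceForm N ρ) (o : SurfaceOrientation M) {x : M → N}
    (hx : IsIsometricImmersion x) {p : M} {e : TangentSpace (𝓡 2) p} (he : ‖e‖ = 1)
    (v : TangentSpace (𝓡 2) p) :
    mvfderiv (𝓡 2) (kaehlerCos S o x) p v
      = ⟪S.J (x p) (secondFundamentalForm S x p v e), mfderiv (𝓡 2) (𝓡 4) x p (o.rot p e)⟫_ℝ
        + ⟪S.J (x p) (mfderiv (𝓡 2) (𝓡 4) x p e),
          secondFundamentalForm S x p v (o.rot p e)⟫_ℝ := by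
  set X := FiberBundle.extend E2 e with hX
  set Y := FiberBundle.extend E2 (o.rot p e) with hY
  have hXp : X p = e := FiberBundle.extend_apply_self ..
  have hYp : Y p = o.rot p e := FiberBundle.extend_apply_self ..
  set dX : ∀ q : M, TangentSpace (𝓡 4) (x q) := fun q ↦ mfderiv (𝓡 2) (𝓡 4) x q (X q) with hdX
  set dY : ∀ q : M, TangentSpace (𝓡 4) (x q) := fun q ↦ mfderiv (𝓡 2) (𝓡 4) x q (Y q) with hdY
  have hxd : MDifferentiableAt (𝓡 2) (𝓡 4) x p := (hx.smooth p).mdifferentiableAt (by simp)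
  have hXd : MDifferentiableAt (𝓡 2) ((𝓡 4).prod 𝓘(ℝ, E4))
      (fun q ↦ (⟨x q, dX q⟩ : TangentBundle (𝓡 4) N)) p :=
    (contMDiffAt_mfderiv_extend hx.smooth p e).mdifferentiableAt (by simp)
  have hYd : MDifferentiableAt (𝓡 2) ((𝓡 4).prod 𝓘(ℝ, E4))
      (fun q ↦ (⟨x q, dY q⟩ : TangentBundle (𝓡 4) N)) p :=
    (contMDiffAt_mfderiv_extend hx.smooth p (o.rot p e)).mdifferentiableAt (by simp)
  have hCd := ((contMDiff_kaehlerCos S o hx).contMDiffAt (x := p)).mdifferentiableAt (by simp)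
  set g : M → ℝ := fun q ↦ ⟪o.rot q (X q), Y q⟫_ℝ with hg
  have hgd : MDifferentiableAt (𝓡 2) 𝓘(ℝ, ℝ) g p :=
    (contMDiffAt_inner_rot_extend o p e (o.rot p e)).mdifferentiableAt (by simp)
  have hgp : g p = 1 := by rw [hg]; simp only [hXp, hYp, inner_rot_rot_self o he]
  have hJ := mvfderiv_inner_J_covAlong S hxd hXd hYd v
  have hXX := mvfderiv_inner_covAlong S hxd hXd hXd v
  have hYY := mvfderiv_inner_covAlong S hxd hYd hYd v
  have iXX : MDifferentiableAt (𝓡 2) 𝓘(ℝ, ℝ) (fun q ↦ ⟪dX q, dX q⟫_ℝ) p := hXd.inner_bundle hXd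
  have iXY : MDifferentiableAt (𝓡 2) 𝓘(ℝ, ℝ) (fun q ↦ ⟪dX q, dY q⟫_ℝ) p := hXd.inner_bundle hYd
  have iYY : MDifferentiableAt (𝓡 2) 𝓘(ℝ, ℝ) (fun q ↦ ⟪dY q, dY q⟫_ℝ) p := hYd.inner_bundle hYd
  have hdXp : dX p = mfderiv (𝓡 2) (𝓡 4) x p e := by rw [hdX]; simp only [hXp]
  have hdYp : dY p = mfderiv (𝓡 2) (𝓡 4) x p (o.rot p e) := by rw [hdY]; simp only [hYp]
  obtain ⟨u, hu⟩ := exists_eq_mfderiv_add_normalPart x p (covAlong S x dX p v)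
  obtain ⟨u', hu'⟩ := exists_eq_mfderiv_add_normalPart x p (covAlong S x dY p v)
  change covAlong S x dX p v = _ + secondFundamentalForm S x p v e at hu
  change covAlong S x dY p v = _ + secondFundamentalForm S x p v (o.rot p e) at hu'
  have hB : ∀ w z, ⟪secondFundamentalForm S x p v w, mfderiv (𝓡 2) (𝓡 4) x p z⟫_ℝ = 0 :=
    fun w z ↦ inner_normalPart_mfderiv ..
  have hB' : ∀ w z, ⟪mfderiv (𝓡 2) (𝓡 4) x p z, secondFundamentalForm S x p v w⟫_ℝ = 0 :=
    fun w z ↦ by rw [real_inner_comm, hB]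
  rw [mvfderiv_eq_of_mul_eq hCd hgd iXY iXX iYY
    (fun q ↦ by simp only [hg, hdX, hdY, hx.isometric]; exact inner_rot_sq o _ _)
    (fun q ↦ inner_J_mfderiv S o x (X q) (Y q)) hgp
    (by rw [hdXp, hdYp, hx.isometric, inner_self_rot])
    (by rw [hdXp, hx.isometric, inner_self_of_norm_eq_one he])
    (by rw [hdYp, hx.isometric, inner_rot_rot_self o he]) v]
  change mvfderiv (𝓡 2) (fun q ↦ ⟪S.J (x q) (dX q), dY q⟫_ℝ) p v - _ = _
  rw [hJ, hXX, hYY, hdXp, hdYp, hu, hu']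
  simp only [map_add, inner_add_left, inner_add_right, hB, hB', hx.isometric,
    inner_J_mfderiv S o, o.rot_inner]
  rw [real_inner_comm u e, real_inner_comm u' (o.rot p e)]
  ring

end

/-! ### The differential of the Kähler angle and the form φ. -/

section

open Set Filter Topology

section Critical

variable {M : Type*} [TopologicalSpace M] [ChartedSpace E2 M]

/-- No differentiability is assumed: where it fails the derivative is 0 by convention. This is what
allows arccos at ±1. -/
theorem mvfderiv_eq_zero_of_isLocalExtr {f : M → ℝ} {p : M} (hf : IsLocalExtr f p) :
    mvfderiv (𝓡 2) f p = 0 := by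
  have h : mfderiv (𝓡 2) 𝓘(ℝ, ℝ) f p = 0 := by
    by_cases hd : MDifferentiableAt (𝓡 2) 𝓘(ℝ, ℝ) f p
    · rw [hd.mfderiv]
      simp only [ModelWithCorners.range_eq_univ, fderivWithin_univ]
      have : IsLocalExtr (f ∘ (extChartAt (𝓡 2) p).symm) (extChartAt (𝓡 2) p p) := by
        refine IsExtrFilter.comp_tendsto ?_
          ((continuousAt_extChartAt_symm (I := 𝓡 2) p))
        rw [extChartAt_to_inv]
        exact hf
      exact this.fderiv_eq_zero
    · exact mfderiv_zero_of_not_mdifferentiableAt hd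
  ext v
  exact congr($h v)

end Critical

variable {M : Type*} [TopologicalSpace M] [ChartedSpace E2 M] [IsManifold (𝓡 2) ∞ M]
  [RiemannianBundle (fun p : M ↦ TangentSpace (𝓡 2) p)]
  [IsContMDiffRiemannianBundle (𝓡 2) ∞ E2 (fun p : M ↦ TangentSpace (𝓡 2) p)]
  {N : Type*} [TopologicalSpace N] [ChartedSpace E4 N] [IsManifold (𝓡 4) ∞ N]
  [RiemannianBundle (fun y : N ↦ TangentSpace (𝓡 4) y)]
  [IsContMDiffRiemannianBundle (𝓡 4) ∞ E4 (fun y : N ↦ TangentSpace (𝓡 4) y)]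
  {ρ : ℝ} (S : ComplexSpaceForm N ρ) (o : SurfaceOrientation M) {x : M → N}

theorem sin_kaehlerAngle_ne_zero_iff (p : M) :
    Real.sin (kaehlerAngle S o x p) ≠ 0 ↔ -1 < kaehlerCos S o x p ∧ kaehlerCos S o x p < 1 := by
  rw [kaehlerAngle_eq, Real.sin_arccos, Real.sqrt_ne_zero', sub_pos, sq_lt_one_iff_abs_lt_one,
    abs_lt]

theorem sin_kaehlerAngle_ne_zero_of_mvfderiv_kaehlerCos (hx : IsIsometricImmersion x) {p : M}
    (hp : mvfderiv (𝓡 2) (kaehlerCos S o x) p ≠ 0) : Real.sin (kaehlerAngle S o x p) ≠ 0 := by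
  rw [sin_kaehlerAngle_ne_zero_iff]
  have h q := abs_le.1 (abs_kaehlerCos_le_one S o hx q)
  refine ⟨(h p).1.lt_of_ne' fun h1 ↦ hp ?_, (h p).2.lt_of_ne fun h1 ↦ hp ?_⟩
  · exact mvfderiv_eq_zero_of_isLocalExtr (Or.inl (Eventually.of_forall fun q ↦ h1 ▸ (h q).1))
  · exact mvfderiv_eq_zero_of_isLocalExtr (Or.inr (Eventually.of_forall fun q ↦ h1 ▸ (h q).2))

/-- If sin α = 0, then α is 0 or π, a minimum or maximum of its range. -/
theorem sin_kaehlerAngle_ne_zero_of_mvfderiv (hx : IsIsometricImmersion x) {p : M}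
    (hp : mvfderiv (𝓡 2) (kaehlerAngle S o x) p ≠ 0) : Real.sin (kaehlerAngle S o x p) ≠ 0 := by
  rw [sin_kaehlerAngle_ne_zero_iff]
  have h q := abs_le.1 (abs_kaehlerCos_le_one S o hx q)
  refine ⟨(h p).1.lt_of_ne' fun h1 ↦ hp ?_, (h p).2.lt_of_ne fun h1 ↦ hp ?_⟩
  · refine mvfderiv_eq_zero_of_isLocalExtr (Or.inr (Eventually.of_forall fun q ↦ ?_))
    simp only [kaehlerAngle_eq, h1, Real.arccos_neg_one]
    exact Real.arccos_le_pi _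
  · refine mvfderiv_eq_zero_of_isLocalExtr (Or.inl (Eventually.of_forall fun q ↦ ?_))
    simp only [kaehlerAngle_eq, h1, Real.arccos_one]
    exact Real.arccos_nonneg _

theorem contMDiffAt_kaehlerAngle (hx : IsIsometricImmersion x) {p : M}
    (hp : Real.sin (kaehlerAngle S o x p) ≠ 0) :
    ContMDiffAt (𝓡 2) 𝓘(ℝ, ℝ) ∞ (kaehlerAngle S o x) p := by
  obtain ⟨h1, h2⟩ := (sin_kaehlerAngle_ne_zero_iff S o p).1 hp
  exact (Real.contDiffAt_arccos h1.ne' h2.ne).contMDiffAt.comp p (contMDiff_kaehlerCos S o hx p)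

theorem mvfderiv_kaehlerAngle (hx : IsIsometricImmersion x) {p : M}
    (hp : Real.sin (kaehlerAngle S o x p) ≠ 0) (v : TangentSpace (𝓡 2) p) :
    mvfderiv (𝓡 2) (kaehlerAngle S o x) p v
      = -(Real.sin (kaehlerAngle S o x p))⁻¹ * mvfderiv (𝓡 2) (kaehlerCos S o x) p v := by
  obtain ⟨h1, h2⟩ := (sin_kaehlerAngle_ne_zero_iff S o p).1 hp
  have hd := (Real.hasDerivAt_arccos h1.ne' h2.ne).hasFDerivAt.hasMFDerivAt.comp p
    ((contMDiff_kaehlerCos S o hx p).mdifferentiableAt (by simp)).hasMFDerivAt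
  have h3 := DFunLike.congr_fun hd.mfderiv v
  have h4 : mvfderiv (𝓡 2) (kaehlerAngle S o x) p v
    = mvfderiv (𝓡 2) (kaehlerCos S o x) p v * -(1 / √(1 - kaehlerCos S o x p ^ 2)) := h3
  rw [h4, ← Real.sin_arccos, kaehlerAngle_eq]
  ring

theorem mvfderiv_kaehlerAngle_eq_inner (hx : IsIsometricImmersion x) {p : M}
    (hp : Real.sin (kaehlerAngle S o x p) ≠ 0) {e : TangentSpace (𝓡 2) p} (he : ‖e‖ = 1)
    (v : TangentSpace (𝓡 2) p) :
    mvfderiv (𝓡 2) (kaehlerAngle S o x) p v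
      = -(⟪normalVec3 S o x e (o.rot p e), secondFundamentalForm S x p v e⟫_ℝ
        + ⟪normalVec4 S o x e (o.rot p e), secondFundamentalForm S x p v (o.rot p e)⟫_ℝ) := by
  have hB : ∀ w z, ⟪mfderiv (𝓡 2) (𝓡 4) x p z, secondFundamentalForm S x p v w⟫_ℝ = 0 :=
    fun w z ↦ by rw [real_inner_comm, secondFundamentalForm, inner_normalPart_mfderiv]
  rw [mvfderiv_kaehlerAngle S o hx hp, mvfderiv_kaehlerCos S o hx he, inner_J_left,
    real_inner_comm _ (secondFundamentalForm S x p v e)]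
  simp only [normalVec3, normalVec4, real_inner_smul_left, inner_add_left, inner_sub_left, hB]
  ring

theorem AdaptedFrame.phi_rot {p : M} (F : AdaptedFrame S o x p) (w : TangentSpace (𝓡 2) p) :
    F.phi (o.rot p w) = Complex.I * F.phi w := by
  have h1 : ⟪F.e₁, o.rot p w⟫_ℝ = -⟪F.e₂, w⟫_ℝ := by rw [F.e₂_eq, inner_rot_left, neg_neg]
  have h2 : ⟪F.e₂, o.rot p w⟫_ℝ = ⟪F.e₁, w⟫_ℝ := by rw [F.e₂_eq, o.rot_inner]
  rw [phi, phi, h1, h2]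
  push_cast
  linear_combination (-(⟪F.e₂, w⟫_ℝ : ℂ)) * Complex.I_sq

/-- In an adapted frame ⟨e₃, H⟩ = -|H| and ⟨e₄, H⟩ = 0. With these two relations, the sums in dα(e₁)
and dα(e₂) become the real and the negative imaginary part of 2(a + b). -/
theorem AdaptedFrame.mvfderiv_kaehlerAngle_eq_re (hx : IsIsometricImmersion x) {p : M}
    (hp : Real.sin (kaehlerAngle S o x p) ≠ 0) (F : AdaptedFrame S o x p)
    (w : TangentSpace (𝓡 2) p) :
    mvfderiv (𝓡 2) (kaehlerAngle S o x) p w = 2 * ((F.a + (halfMean S x p : ℂ)) * F.phi w).re := by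
  obtain ⟨e, _, he, rfl, hH⟩ := F
  have h3H : ⟪normalVec3 S o x e (o.rot p e), meanCurvature S x p⟫_ℝ
      = -‖meanCurvature S x p‖ := by
    conv_lhs => rw [hH]
    rw [real_inner_smul_right, inner_normalVec3_self S o hx hp he, mul_one]
  have h4H : ⟪normalVec4 S o x e (o.rot p e), meanCurvature S x p⟫_ℝ = 0 := by
    conv_lhs => rw [hH]
    rw [real_inner_smul_right, real_inner_comm, inner_normalVec3_normalVec4 S o hx, mul_zero]
  have hmean := meanCurvature_eq_of_norm_eq_one S o hx he
  rw [hmean, real_inner_smul_right, inner_add_right] at h4H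
  replace h3H := (congrArg (fun z ↦ ⟪normalVec3 S o x e (o.rot p e), z⟫_ℝ) hmean).symm.trans h3H
  rw [real_inner_smul_right, inner_add_right] at h3H
  rw [mvfderiv_kaehlerAngle_eq_inner S o hx hp he]
  have hw := eq_smul_add_smul_rot o he w
  have hB1 : secondFundamentalForm S x p w e = ⟪e, w⟫_ℝ • secondFundamentalForm S x p e e
      + ⟪o.rot p e, w⟫_ℝ • secondFundamentalForm S x p e (o.rot p e) := by
    conv_lhs => rw [hw]
    rw [secondFundamentalForm_add_left, secondFundamentalForm_smul_left,
      secondFundamentalForm_smul_left, secondFundamentalForm_symm S hx.smooth p (o.rot p e) e]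
  have hB2 : secondFundamentalForm S x p w (o.rot p e)
      = ⟪e, w⟫_ℝ • secondFundamentalForm S x p e (o.rot p e)
      + ⟪o.rot p e, w⟫_ℝ • secondFundamentalForm S x p (o.rot p e) (o.rot p e) := by
    conv_lhs => rw [hw]
    rw [secondFundamentalForm_add_left, secondFundamentalForm_smul_left,
      secondFundamentalForm_smul_left]
  rw [hB1, hB2]
  simp only [inner_add_right, real_inner_smul_right]
  simp only [a, phi, complexForm, halfMean]
  simp only [Complex.add_re, Complex.mul_re, Complex.mul_im, Complex.add_im, Complex.sub_re,
    Complex.sub_im, Complex.ofReal_re, Complex.ofReal_im, Complex.I_re, Complex.I_im,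
    Complex.neg_re, Complex.neg_im, Complex.div_re, Complex.div_im, Complex.one_re, Complex.one_im]
  norm_num
  linear_combination (-⟪e, w⟫_ℝ) * h3H - ⟪o.rot p e, w⟫_ℝ * h4H

/-- For z = (a + b) φ(w), rotating w multiplies z by i, and Re(iz) = -Im z; so dα on w and rot w
recovers all of z. -/
theorem AdaptedFrame.two_mul_phi (hx : IsIsometricImmersion x) {p : M}
    (hp : Real.sin (kaehlerAngle S o x p) ≠ 0) (F : AdaptedFrame S o x p)
    (w : TangentSpace (𝓡 2) p) :
    2 * (F.a + (halfMean S x p : ℂ)) * F.phi w = (mvfderiv (𝓡 2) (kaehlerAngle S o x) p w : ℂ)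
      - Complex.I * (mvfderiv (𝓡 2) (kaehlerAngle S o x) p (o.rot p w) : ℂ) := by
  rw [F.mvfderiv_kaehlerAngle_eq_re S o hx hp, F.mvfderiv_kaehlerAngle_eq_re S o hx hp, F.phi_rot,
    show (F.a + (halfMean S x p : ℂ)) * (Complex.I * F.phi w)
      = Complex.I * ((F.a + (halfMean S x p : ℂ)) * F.phi w) by ring]
  rw [mul_assoc]
  generalize (F.a + (halfMean S x p : ℂ)) * F.phi w = z
  apply Complex.ext <;> simp

theorem AdaptedFrame.a_add_halfMean_ne_zero (hx : IsIsometricImmersion x) {p : M}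
    (hp : mvfderiv (𝓡 2) (kaehlerAngle S o x) p ≠ 0) (F : AdaptedFrame S o x p) :
    F.a + (halfMean S x p : ℂ) ≠ 0 := by
  intro h
  apply hp
  ext w
  rw [F.mvfderiv_kaehlerAngle_eq_re S o hx (sin_kaehlerAngle_ne_zero_of_mvfderiv S o hx hp), h]
  simp

end

/-! ### Calculus in charts, the rotation field, and integrating factors on the surface. -/

section

open Set Filter Topology

variable {M : Type*} [TopologicalSpace M] [ChartedSpace E2 M] [IsManifold (𝓡 2) ∞ M]

/-! ### Derivatives in charts -/

section Chart

variable {e : OpenPartialHomeomorph M E2} (he : e ∈ IsManifold.maximalAtlas (𝓡 2) ∞ M)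
include he

theorem mdifferentiableAt_chart {q : M} (hq : q ∈ e.source) :
    MDifferentiableAt (𝓡 2) (𝓡 2) e q :=
  (contMDiffAt_of_mem_maximalAtlas he hq).mdifferentiableAt (by simp)

theorem mdifferentiableAt_chart_symm {z : E2} (hz : z ∈ e.target) :
    MDifferentiableAt (𝓡 2) (𝓡 2) e.symm z :=
  (contMDiffAt_symm_of_mem_maximalAtlas he hz).mdifferentiableAt (by simp)

theorem mfderiv_chart_symm_apply {q : M} (hq : q ∈ e.source) (w : TangentSpace (𝓡 2) q) :
    mfderiv (𝓡 2) (𝓡 2) e.symm (e q) (mfderiv (𝓡 2) (𝓡 2) e q w) = w := by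
  have h1 := (mdifferentiableAt_chart_symm he (e.map_source hq)).hasMFDerivAt.comp q
    (mdifferentiableAt_chart he hq).hasMFDerivAt
  have h2 : HasMFDerivAt (𝓡 2) (𝓡 2) (e.symm ∘ e) q
      (ContinuousLinearMap.id ℝ (TangentSpace (𝓡 2) q)) := by
    refine (hasMFDerivAt_id q).congr_of_eventuallyEq ?_
    filter_upwards [e.open_source.mem_nhds hq] with q' hq'
    exact e.left_inv hq'
  have h3 := h1.mfderiv.symm.trans h2.mfderiv
  exact DFunLike.congr_fun h3 w

theorem mfderiv_chart_apply_symm {z : E2} (hz : z ∈ e.target) (v : E2) :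
    mfderiv (𝓡 2) (𝓡 2) e (e.symm z) (mfderiv (𝓡 2) (𝓡 2) e.symm z v) = v := by
  have h1 := (mdifferentiableAt_chart he (e.map_target hz)).hasMFDerivAt.comp z
    (mdifferentiableAt_chart_symm he hz).hasMFDerivAt
  have h2 : HasMFDerivAt (𝓡 2) (𝓡 2) (e ∘ e.symm) z (ContinuousLinearMap.id ℝ E2) := by
    refine (hasMFDerivAt_id z).congr_of_eventuallyEq ?_
    filter_upwards [e.open_target.mem_nhds hz] with z' hz'
    exact e.right_inv hz'
  have h3 := h1.mfderiv.symm.trans h2.mfderiv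
  exact DFunLike.congr_fun h3 v

theorem fderiv_comp_chart_symm {f : M → ℝ} {z : E2} (hz : z ∈ e.target)
    (hf : MDifferentiableAt (𝓡 2) 𝓘(ℝ, ℝ) f (e.symm z)) (v : E2) :
    fderiv ℝ (f ∘ e.symm) z v = mvfderiv (𝓡 2) f (e.symm z) (mfderiv (𝓡 2) (𝓡 2) e.symm z v) := by
  have h := hf.hasMFDerivAt.comp z (mdifferentiableAt_chart_symm he hz).hasMFDerivAt
  have h2 : mfderiv 𝓘(ℝ, E2) 𝓘(ℝ, ℝ) (f ∘ e.symm) z = _ := h.mfderiv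
  rw [mfderiv_eq_fderiv] at h2
  exact DFunLike.congr_fun h2 v

theorem differentiableAt_comp_chart_symm {f : M → ℝ} {z : E2} (hz : z ∈ e.target)
    (hf : MDifferentiableAt (𝓡 2) 𝓘(ℝ, ℝ) f (e.symm z)) :
    DifferentiableAt ℝ (f ∘ e.symm) z :=
  (hf.comp z (mdifferentiableAt_chart_symm he hz)).differentiableAt

theorem mvfderiv_eq_fderiv_comp_chart_symm {f : M → ℝ} {q : M} (hq : q ∈ e.source)
    (hf : MDifferentiableAt (𝓡 2) 𝓘(ℝ, ℝ) f q) (w : TangentSpace (𝓡 2) q) :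
    mvfderiv (𝓡 2) f q w = fderiv ℝ (f ∘ e.symm) (e q) (mfderiv (𝓡 2) (𝓡 2) e q w) := by
  have h := e.left_inv hq
  refine Eq.trans ?_ (fderiv_comp_chart_symm he (e.map_source hq) (h.symm ▸ hf) _).symm
  -- The points `e.symm (e q)` and `q` are equal but not definitionally; since all tangent spaces
  -- are `E2`, the derivatives can be compared on the same vector.
  have key : ∀ q', q' = q → ∀ u : E2,
      (mvfderiv (𝓡 2) f q u : ℝ) = mvfderiv (𝓡 2) f q' u := by
    rintro _ rfl u
    rfl
  exact (congrArg (fun u : E2 ↦ (mvfderiv (𝓡 2) f q u : ℝ))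
    (mfderiv_chart_symm_apply he hq w).symm).trans (key _ h _)

theorem contDiffOn_comp_chart_symm {f : M → ℝ} {U : Set M}
    (hf : ContMDiffOn (𝓡 2) 𝓘(ℝ, ℝ) ∞ f U) :
    ContDiffOn ℝ ∞ (f ∘ e.symm) (e.target ∩ e.symm ⁻¹' U) :=
  (hf.comp ((contMDiffOn_symm_of_mem_maximalAtlas he).mono inter_subset_left)
    inter_subset_right).contDiffOn

end Chart

theorem eq_of_mvfderiv_eq_zero [ConnectedSpace M] {f : M → ℝ}
    (hf : MDifferentiable (𝓡 2) 𝓘(ℝ, ℝ) f) (h : ∀ p, mvfderiv (𝓡 2) f p = 0) (p q : M) :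
    f p = f q := by
  refine IsLocallyConstant.apply_eq_of_preconnectedSpace ?_ p q
  rw [IsLocallyConstant.iff_eventually_eq]
  intro p
  set e := chartAt E2 p
  have he : e ∈ IsManifold.maximalAtlas (𝓡 2) ∞ M := IsManifold.chart_mem_maximalAtlas p
  have hp : p ∈ e.source := mem_chart_source E2 p
  obtain ⟨r, hr, hball⟩ := Metric.isOpen_iff.1 e.open_target _ (e.map_source hp)
  have hnear : ∀ᶠ q in 𝓝 p, q ∈ e.source ∧ e q ∈ Metric.ball (e p) r :=
    (e.open_source.mem_nhds hp |> Filter.eventually_mem_set.2).and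
      ((e.continuousAt hp).eventually (Metric.ball_mem_nhds _ hr))
  filter_upwards [hnear] with q hq
  have key := Metric.isOpen_ball.is_const_of_fderiv_eq_zero (𝕜 := ℝ) (f := f ∘ e.symm)
    (convex_ball (e p) r).isPreconnected
    (fun z hz ↦ (differentiableAt_comp_chart_symm he (hball hz) (hf _)).differentiableWithinAt)
    (fun z hz ↦ by
      ext v
      rw [fderiv_comp_chart_symm he (hball hz) (hf _), h]
      rfl)
    hq.2 (Metric.mem_ball_self hr)
  simpa [e.left_inv hq.1, e.left_inv hp] using key

/-! ### The rotation field in coordinates -/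

section Rotation

variable [RiemannianBundle (fun p : M ↦ TangentSpace (𝓡 2) p)]
  [IsContMDiffRiemannianBundle (𝓡 2) ∞ E2 (fun p : M ↦ TangentSpace (𝓡 2) p)]

/-- The rotation field in the coordinates of the preferred chart at `p`. -/
def rotCoord (o : SurfaceOrientation M) (p : M) (z : E2) : E2 →L[ℝ] E2 :=
  (trivializationAt (E2 →L[ℝ] E2) (fun q : M ↦ TangentSpace (𝓡 2) q →L[ℝ] TangentSpace (𝓡 2) q) p
    ⟨(chartAt E2 p).symm z, o.rot ((chartAt E2 p).symm z)⟩).2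

theorem contDiffOn_rotCoord (o : SurfaceOrientation M) (p : M) :
    ContDiffOn ℝ ∞ (rotCoord o p) (chartAt E2 p).target := by
  have h1 := ((trivializationAt (E2 →L[ℝ] E2)
    (fun q : M ↦ TangentSpace (𝓡 2) q →L[ℝ] TangentSpace (𝓡 2) q) p).contMDiffOn_section_baseSet_iff
    (IB := 𝓡 2) (n := ∞)).1 (o.rot_smooth.contMDiffOn)
  have h2 := h1.comp (contMDiffOn_symm_of_mem_maximalAtlas (I := 𝓡 2) (n := ∞)
    (IsManifold.chart_mem_maximalAtlas p)) (fun z hz ↦ by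
      have := (chartAt E2 p).map_target hz
      simpa [hom_trivializationAt_baseSet, TangentBundle.trivializationAt_baseSet] using this)
  exact h2.contDiffOn

/-- The trivialization of the bundle of endomorphisms conjugates by the differential of the chart.
-/
theorem rotCoord_apply (o : SurfaceOrientation M) (p : M) {q : M}
    (hq : q ∈ (chartAt E2 p).source) (w : TangentSpace (𝓡 2) q) :
    rotCoord o p (chartAt E2 p q) (mfderiv (𝓡 2) (𝓡 2) (chartAt E2 p) q w)
      = mfderiv (𝓡 2) (𝓡 2) (chartAt E2 p) q (o.rot q w) := by
  set t := trivializationAt E2 (fun q : M ↦ TangentSpace (𝓡 2) q) p with ht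
  have hqt : q ∈ t.baseSet := by simpa [ht, TangentBundle.trivializationAt_baseSet] using hq
  have hD : ∀ u : TangentSpace (𝓡 2) q,
      mfderiv (𝓡 2) (𝓡 2) (chartAt E2 p) q u = t.continuousLinearMapAt ℝ q u := fun u ↦
    (DFunLike.congr_fun (TangentBundle.continuousLinearMapAt_trivializationAt hq) u).symm
  rw [hD, hD, rotCoord, hom_trivializationAt_apply, (chartAt E2 p).left_inv hq]
  dsimp only
  rw [ContinuousLinearMap.inCoordinates_eq hqt hqt]
  have h1 : t.continuousLinearMapAt ℝ q w = t.continuousLinearEquivAt ℝ q hqt w :=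
    (congrFun (t.coe_continuousLinearEquivAt_eq hqt) w).symm
  have h2 : t.continuousLinearMapAt ℝ q (o.rot q w)
      = t.continuousLinearEquivAt ℝ q hqt (o.rot q w) :=
    (congrFun (t.coe_continuousLinearEquivAt_eq hqt) _).symm
  rw [h1, h2]
  exact congrArg (fun u ↦ t.continuousLinearEquivAt ℝ q hqt (o.rot q u))
    ((t.continuousLinearEquivAt ℝ q hqt).symm_apply_apply w)

/-- In a chart df ∘ rot is a smooth one-form without zeros near p, so it has an integrating factor
there, which is carried back to the surface. -/
theorem exists_mvfderiv_eq_smul_rot (o : SurfaceOrientation M) {f : M → ℝ} {p : M} {U : Set M}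
    (hU : IsOpen U) (hpU : p ∈ U) (hf : ContMDiffOn (𝓡 2) 𝓘(ℝ, ℝ) ∞ f U)
    (hp : mvfderiv (𝓡 2) f p ≠ 0) :
    ∃ V ⊆ U, IsOpen V ∧ p ∈ V ∧ ∃ β k : M → ℝ,
      ContMDiffOn (𝓡 2) 𝓘(ℝ, ℝ) ∞ β V ∧ ContMDiffOn (𝓡 2) 𝓘(ℝ, ℝ) ∞ k V ∧
      ∀ q ∈ V, mvfderiv (𝓡 2) f q ≠ 0 ∧ k q ≠ 0 ∧
        ∀ w, mvfderiv (𝓡 2) β q w = k q * mvfderiv (𝓡 2) f q (o.rot q w) := by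
  set e := chartAt E2 p with hedef
  have he : e ∈ IsManifold.maximalAtlas (𝓡 2) ∞ M := IsManifold.chart_mem_maximalAtlas p
  have hps : p ∈ e.source := mem_chart_source E2 p
  have hfd : ∀ q ∈ U, MDifferentiableAt (𝓡 2) 𝓘(ℝ, ℝ) f q := fun q hq ↦
    (hf.contMDiffAt (hU.mem_nhds hq)).mdifferentiableAt (by simp)
  set Ω : Set E2 := e.target ∩ e.symm ⁻¹' U with hΩdef
  have hΩ : IsOpen Ω := e.isOpen_inter_preimage_symm hU
  set θ : E2 → E2 →L[ℝ] ℝ := fun z ↦ (fderiv ℝ (f ∘ e.symm) z).comp (rotCoord o p z) with hθdef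
  have hθ : ContDiffOn ℝ ∞ θ Ω := by
    refine ContDiffOn.clm_comp ?_ ((contDiffOn_rotCoord o p).mono inter_subset_left)
    exact (contDiffOn_comp_chart_symm he hf).fderiv_of_isOpen hΩ (by norm_cast)
  have hθq : ∀ q ∈ e.source, q ∈ U → ∀ w : TangentSpace (𝓡 2) q,
      θ (e q) (mfderiv (𝓡 2) (𝓡 2) e q w) = mvfderiv (𝓡 2) f q (o.rot q w) := by
    intro q hq hqU w
    rw [mvfderiv_eq_fderiv_comp_chart_symm he hq (hfd q hqU)]
    exact congrArg _ (rotCoord_apply o p hq w)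
  set Ω' : Set E2 := Ω ∩ {z | θ z ≠ 0} with hΩ'def
  have hΩ' : IsOpen Ω' := hθ.continuousOn.isOpen_inter_preimage hΩ isOpen_ne
  have hz₀ : e p ∈ Ω' := by
    refine ⟨⟨e.map_source hps, by simpa [e.left_inv hps] using hpU⟩, fun h0 ↦ hp ?_⟩
    ext w
    -- Since rot(-rot w) = w, vanishing of df ∘ rot would force df = 0.
    have := hθq p hps hpU (-o.rot p w)
    rw [h0, map_neg (o.rot p), o.rot_sq, neg_neg] at this
    exact this.symm
  obtain ⟨O, hOΩ, hO, hpO, β, k, hβ, hk, hβk⟩ :=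
    exists_integratingFactor (by simp) hΩ' (hθ.mono inter_subset_left) hz₀ hz₀.2
  refine ⟨e.source ∩ e ⁻¹' O, ?_, e.isOpen_inter_preimage hO, ⟨hps, hpO⟩, β ∘ e, k ∘ e, ?_, ?_, ?_⟩
  · rintro q ⟨hq, hqO⟩
    have := (hOΩ hqO).1.2
    simpa [e.left_inv hq] using this
  · exact hβ.contMDiffOn.comp ((contMDiffOn_of_mem_maximalAtlas he).mono inter_subset_left)
      inter_subset_right
  · exact hk.contMDiffOn.comp ((contMDiffOn_of_mem_maximalAtlas he).mono inter_subset_left)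
      inter_subset_right
  · rintro q ⟨hq, hqO⟩
    have hqU : q ∈ U := by
      have := (hOΩ hqO).1.2
      simpa [e.left_inv hq] using this
    refine ⟨fun h0 ↦ (hOΩ hqO).2 ?_, (hβk _ hqO).1, fun w ↦ ?_⟩
    · have h1 : fderiv ℝ (f ∘ e.symm) (e q) = 0 := by
        ext v
        rw [fderiv_comp_chart_symm he (e.map_source hq) (by rw [e.left_inv hq]; exact hfd q hqU),
          e.left_inv hq, h0]
        rfl
      change (fderiv ℝ (f ∘ e.symm) (e q)).comp _ = 0
      rw [h1, ContinuousLinearMap.zero_comp]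
    · have h1 := (hβk _ hqO).2.hasMFDerivAt.comp q (mdifferentiableAt_chart he hq).hasMFDerivAt
      have h2 := DFunLike.congr_fun h1.mfderiv w
      rw [← hθq q hq hqU w]
      exact h2

end Rotation

end

/-! ### The divergence equation and coordinates from two functions. -/

section

open Set Filter Topology

/-- Equality of the mixed derivatives of B reads (K F_b)_b = -(K F_a)_a. -/
theorem divergence_eq_zero_of_conjugate {E : Type*} [NormedAddCommGroup E] [NormedSpace ℝ E]
    {F B K : E → ℝ} {Z : Set E} (hZ : IsOpen Z) (hF : ContDiffOn ℝ ∞ F Z) (hB : ContDiffOn ℝ ∞ B Z)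
    (hK : ContDiffOn ℝ ∞ K Z) (a b : E) (ha : ∀ z ∈ Z, fderiv ℝ B z a = K z * fderiv ℝ F z b)
    (hb : ∀ z ∈ Z, fderiv ℝ B z b = -(K z * fderiv ℝ F z a)) {z : E} (hz : z ∈ Z) :
    fderiv ℝ F z a * fderiv ℝ K z a + fderiv ℝ F z b * fderiv ℝ K z b
      + (fderiv ℝ (fun z ↦ fderiv ℝ F z a) z a + fderiv ℝ (fun z ↦ fderiv ℝ F z b) z b) * K z
      = 0 := by
  have hd : ∀ {G : E → ℝ}, ContDiffOn ℝ ∞ G Z → DifferentiableAt ℝ (fderiv ℝ G) z := fun hG ↦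
    ((hG.contDiffAt (hZ.mem_nhds hz)).fderiv_right (m := 1) (by norm_cast)).differentiableAt
      (by simp)
  have hKd : DifferentiableAt ℝ K z :=
    (hK.contDiffAt (hZ.mem_nhds hz)).differentiableAt (by simp)
  have hsymm : IsSymmSndFDerivAt ℝ B z :=
    (hB.contDiffAt (hZ.mem_nhds hz)).isSymmSndFDerivAt (by simp; norm_cast)
  have hap : ∀ {G : E → ℝ}, ContDiffOn ℝ ∞ G Z → ∀ c, HasFDerivAt (fun z ↦ fderiv ℝ G z c)
      ((fderiv ℝ (fderiv ℝ G) z).flip c) z := fun hG c ↦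
    ((ContinuousLinearMap.apply ℝ ℝ c).hasFDerivAt).comp _ (hd hG).hasFDerivAt
  have h1 : HasFDerivAt (fun z ↦ fderiv ℝ B z a) _ z :=
    (hKd.hasFDerivAt.mul (hap hF b)).congr_of_eventuallyEq
      (by filter_upwards [hZ.mem_nhds hz] with z hz using ha z hz)
  have h2 : HasFDerivAt (fun z ↦ fderiv ℝ B z b) _ z :=
    (hKd.hasFDerivAt.mul (hap hF a)).neg.congr_of_eventuallyEq
      (by filter_upwards [hZ.mem_nhds hz] with z hz using hb z hz)
  have e1 := DFunLike.congr_fun ((hap hB a).unique h1) b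
  have e2 := DFunLike.congr_fun ((hap hB b).unique h2) a
  have e3 := hsymm.eq a b
  rw [(hap hF a).fderiv, (hap hF b).fderiv]
  simp only [ContinuousLinearMap.flip_apply, add_apply, smul_apply, neg_apply,
    smul_eq_mul] at e1 e2 ⊢
  linarith

variable {M : Type*} [TopologicalSpace M] [ChartedSpace E2 M] [IsManifold (𝓡 2) ∞ M]

/-- Two functions with independent differentials form a coordinate system. -/
theorem exists_chart_of_injective {f g : M → ℝ} {V : Set M} (hV : IsOpen V) {p : M} (hp : p ∈ V)
    (hf : ContMDiffOn (𝓡 2) 𝓘(ℝ, ℝ) ∞ f V) (hg : ContMDiffOn (𝓡 2) 𝓘(ℝ, ℝ) ∞ g V)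
    (hinj : ∀ q ∈ V, ∀ w, mvfderiv (𝓡 2) f q w = 0 → mvfderiv (𝓡 2) g q w = 0 → w = 0) :
    ∃ χ : OpenPartialHomeomorph M E2, χ ∈ IsManifold.maximalAtlas (𝓡 2) ∞ M ∧ p ∈ χ.source ∧
      χ.source ⊆ V ∧ ∀ q ∈ χ.source, χ q = !₂[f q, g q] := by
  set e := chartAt E2 p with hedef
  have he : e ∈ IsManifold.maximalAtlas (𝓡 2) ∞ M := IsManifold.chart_mem_maximalAtlas p
  have hps : p ∈ e.source := mem_chart_source E2 p
  set Ω : Set E2 := e.target ∩ e.symm ⁻¹' V with hΩdef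
  have hΩ : IsOpen Ω := e.isOpen_inter_preimage_symm hV
  set G : E2 → E2 := fun z ↦ !₂[f (e.symm z), g (e.symm z)] with hGdef
  have hG : ContDiffOn ℝ ∞ G Ω := by
    rw [contDiffOn_euclidean]
    intro i
    fin_cases i
    · exact contDiffOn_comp_chart_symm he hf
    · exact contDiffOn_comp_chart_symm he hg
  have hGd : ∀ z ∈ Ω, DifferentiableAt ℝ G z := fun z hz ↦
    (hG.contDiffAt (hΩ.mem_nhds hz)).differentiableAt (by simp)
  have hcoord : ∀ z ∈ Ω, ∀ v i, fderiv ℝ G z v i = fderiv ℝ (fun z ↦ G z i) z v := by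
    intro z hz v i
    have := ((EuclideanSpace.proj i : E2 →L[ℝ] ℝ).hasFDerivAt).comp z (hGd z hz).hasFDerivAt
    exact (DFunLike.congr_fun this.fderiv v).symm
  have hequiv : ∀ z ∈ Ω, ∃ L : E2 ≃L[ℝ] E2, HasFDerivAt G (L : E2 →L[ℝ] E2) z := by
    intro z hz
    have hker : Function.Injective (fderiv ℝ G z) := by
      rw [injective_iff_map_eq_zero]
      intro v hv
      have h0 := hcoord z hz v 0
      have h1 := hcoord z hz v 1
      rw [hv] at h0 h1
      have hfd := (hf.contMDiffAt (hV.mem_nhds hz.2)).mdifferentiableAt (by simp)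
      have hgd := (hg.contMDiffAt (hV.mem_nhds hz.2)).mdifferentiableAt (by simp)
      have h2 := hinj (e.symm z) hz.2 (mfderiv (𝓡 2) (𝓡 2) e.symm z v)
        ((fderiv_comp_chart_symm he hz.1 hfd v).symm.trans h0.symm)
        ((fderiv_comp_chart_symm he hz.1 hgd v).symm.trans h1.symm)
      have h3 := mfderiv_chart_apply_symm he hz.1 v
      rw [h2] at h3
      exact h3.symm.trans (map_zero _)
    -- Independence of the differentials is injectivity of dG, hence invertibility in dimension two.
    -- It is needed at every point of Ω, for smoothness of the inverse on the whole target.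
    refine ⟨(LinearEquiv.ofInjectiveEndo (fderiv ℝ G z).toLinearMap hker).toContinuousLinearEquiv,
      ?_⟩
    exact (hGd z hz).hasFDerivAt
  have hpΩ : e p ∈ Ω := ⟨e.map_source hps, by simpa [e.left_inv hps] using hp⟩
  obtain ⟨L, hL⟩ := hequiv _ hpΩ
  have hGp := hG.contDiffAt (hΩ.mem_nhds hpΩ)
  set Φ := (hGp.toOpenPartialHomeomorph G hL (by simp)).restrOpen Ω hΩ with hΦdef
  have hΦs : Φ.source ⊆ Ω := fun z hz ↦ hz.2
  have hpΦ : e p ∈ Φ.source := ⟨hGp.mem_toOpenPartialHomeomorph_source hL (by simp), hpΩ⟩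
  have hΦsymm : ContDiffOn ℝ ∞ Φ.symm Φ.target := by
    intro y hy
    have hy' := hΦs (Φ.map_target hy)
    obtain ⟨L', hL'⟩ := hequiv _ hy'
    exact (Φ.contDiffAt_symm hy hL' (hG.contDiffAt (hΩ.mem_nhds hy'))).contDiffWithinAt
  refine ⟨e.trans Φ, ?_, ⟨hps, hpΦ⟩, ?_, ?_⟩
  · refine OpenPartialHomeomorph.mem_maximalAtlas_of_contMDiffOn _ ?_ ?_
    · exact (hG.contMDiffOn.mono hΦs).comp ((contMDiffOn_of_mem_maximalAtlas he).mono
        (fun q hq ↦ hq.1)) (fun q hq ↦ hq.2)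
    · exact (contMDiffOn_symm_of_mem_maximalAtlas he).comp (hΦsymm.contMDiffOn.mono
        (fun q hq ↦ hq.1)) (fun q hq ↦ hq.2)
  · rintro q ⟨hq, hq'⟩
    have := (hΦs hq').2
    simpa [e.left_inv hq] using this
  · rintro q ⟨hq, hq'⟩
    change G (e q) = _
    simp only [hGdef, e.left_inv hq]

end

/-! ### Isothermal coordinates and nonconstancy of the Kähler angle. -/

section

open Set Filter Topology

variable {M : Type*} [TopologicalSpace M] [ChartedSpace E2 M] [IsManifold (𝓡 2) ∞ M]
  [RiemannianBundle (fun p : M ↦ TangentSpace (𝓡 2) p)]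
  [IsContMDiffRiemannianBundle (𝓡 2) ∞ E2 (fun p : M ↦ TangentSpace (𝓡 2) p)]
  {N : Type*} [TopologicalSpace N] [ChartedSpace E4 N] [IsManifold (𝓡 4) ∞ N]
  [RiemannianBundle (fun y : N ↦ TangentSpace (𝓡 4) y)]
  [IsContMDiffRiemannianBundle (𝓡 4) ∞ E4 (fun y : N ↦ TangentSpace (𝓡 4) y)]
  {ρ : ℝ} {S : ComplexSpaceForm N ρ} {o : SurfaceOrientation M} {x : M → N}

/-- A nonzero w and rot w span the tangent plane, so df would vanish. -/
theorem eq_zero_of_mvfderiv_rot (o : SurfaceOrientation M) {f : M → ℝ} {q : M}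
    (hf : mvfderiv (𝓡 2) f q ≠ 0) {w : TangentSpace (𝓡 2) q} (h1 : mvfderiv (𝓡 2) f q w = 0)
    (h2 : mvfderiv (𝓡 2) f q (o.rot q w) = 0) : w = 0 := by
  by_contra hw
  apply hf
  have he : ‖(‖w‖⁻¹ • w)‖ = 1 := norm_smul_inv_norm (𝕜 := ℝ) hw
  have hv : ∀ v, mvfderiv (𝓡 2) f q v = 0 := fun v ↦ by
    rw [eq_smul_add_smul_rot o he v]
    simp only [map_add, map_smul, h1, h2, smul_zero, add_zero]
  ext v
  exact hv v

theorem AdaptedFrame.phi_injective {p : M} (F : AdaptedFrame S o x p) {v w : TangentSpace (𝓡 2) p}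
    (h : F.phi v = F.phi w) : v = w := by
  have hre := congrArg Complex.re h
  have him := congrArg Complex.im h
  simp [phi] at hre him
  rw [eq_smul_add_smul_rot o F.norm_e₁ v, eq_smul_add_smul_rot o F.norm_e₁ w, hre, ← F.e₂_eq, him]

section Isothermal

variable {e : OpenPartialHomeomorph M E2} {q : M}

/-- The coordinate vector fields of a chart. -/
def coordVec (e : OpenPartialHomeomorph M E2) (i : Fin 2) (q : M) : TangentSpace (𝓡 2) q :=
  (mfderiv (𝓡 2) (𝓡 2) e.symm (e q) (EuclideanSpace.single i (1 : ℝ)) : E2)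

theorem chartPartial_eq_mvfderiv (he : e ∈ IsManifold.maximalAtlas (𝓡 2) ∞ M)
    (hq : q ∈ e.source) {f : M → ℝ} (hf : MDifferentiableAt (𝓡 2) 𝓘(ℝ, ℝ) f q) (i : Fin 2) :
    chartPartial e i f q = mvfderiv (𝓡 2) f q (coordVec e i q) := by
  have h1 := mfderiv_chart_apply_symm he (e.map_source hq) (EuclideanSpace.single i (1 : ℝ))
  have h2 : mfderiv (𝓡 2) (𝓡 2) e q (coordVec e i q) = EuclideanSpace.single i (1 : ℝ) := by
    have key : ∀ q', q' = q → ∀ u : E2, (mfderiv (𝓡 2) (𝓡 2) e q u : E2)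
        = (mfderiv (𝓡 2) (𝓡 2) e q' u : E2) := by
      rintro _ rfl u
      rfl
    exact (key _ (e.left_inv hq) _).trans h1
  rw [mvfderiv_eq_fderiv_comp_chart_symm he hq hf, h2]
  rfl

theorem mvfderiv_chart_coordVec (he : e ∈ IsManifold.maximalAtlas (𝓡 2) ∞ M)
    (hq : q ∈ e.source) (i j : Fin 2) :
    mvfderiv (𝓡 2) (fun q' ↦ e q' j) q (coordVec e i q) = if j = i then 1 else 0 := by
  have hd : MDifferentiableAt (𝓡 2) 𝓘(ℝ, ℝ) (fun q' ↦ e q' j) q :=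
    ((EuclideanSpace.proj j : E2 →L[ℝ] ℝ).mdifferentiableAt).comp q (mdifferentiableAt_chart he hq)
  rw [← chartPartial_eq_mvfderiv he hq hd, chartPartial]
  have h1 : HasFDerivAt ((fun q' ↦ e q' j) ∘ e.symm) (EuclideanSpace.proj j : E2 →L[ℝ] ℝ) (e q) := by
    refine (EuclideanSpace.proj j : E2 →L[ℝ] ℝ).hasFDerivAt.congr_of_eventuallyEq ?_
    filter_upwards [e.open_target.mem_nhds (e.map_source hq)] with z hz
    simp [e.right_inv hz]
  rw [h1.fderiv]
  simp

/-- From φ = λ(du + i dv) one gets φ(∂_v) = iφ(∂_u) = φ(rot ∂_u), and φ is injective. -/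
theorem IsIsothermal.coordVec_one_eq_rot (he : IsIsothermal S o x e) (hq : q ∈ e.source)
    (F : AdaptedFrame S o x q) : coordVec e 1 q = o.rot q (coordVec e 0 q) := by
  obtain ⟨l, hl⟩ := he.2 q hq F
  apply F.phi_injective
  rw [F.phi_rot, hl, hl]
  simp only [mvfderiv_chart_coordVec he.1 hq]
  norm_num
  ring

theorem chartPartial_conjugate (he : IsIsothermal S o x e) (hq : q ∈ e.source)
    (F : AdaptedFrame S o x q) {f β : M → ℝ} {c : ℝ}
    (hf : MDifferentiableAt (𝓡 2) 𝓘(ℝ, ℝ) f q) (hβ : MDifferentiableAt (𝓡 2) 𝓘(ℝ, ℝ) β q)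
    (h : ∀ w, mvfderiv (𝓡 2) β q w = c * mvfderiv (𝓡 2) f q (o.rot q w)) :
    chartPartial e 0 β q = c * chartPartial e 1 f q ∧
      chartPartial e 1 β q = -(c * chartPartial e 0 f q) := by
  simp only [chartPartial_eq_mvfderiv he.1 hq hf, chartPartial_eq_mvfderiv he.1 hq hβ, h,
    he.coordVec_one_eq_rot hq F, o.rot_sq, map_neg, mul_neg, and_self]

theorem chartPartial_chartPartial (hq : q ∈ e.source) (i : Fin 2) (f : M → ℝ) :
    chartPartial e i (chartPartial e i f) q
      = fderiv ℝ (fun z ↦ fderiv ℝ (f ∘ e.symm) z (EuclideanSpace.single i 1)) (e q)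
        (EuclideanSpace.single i 1) := by
  have h : chartPartial e i f ∘ e.symm
      =ᶠ[𝓝 (e q)] fun z ↦ fderiv ℝ (f ∘ e.symm) z (EuclideanSpace.single i 1) := by
    filter_upwards [e.open_target.mem_nhds (e.map_source hq)] with z hz
    simp [chartPartial, e.right_inv hz]
  rw [chartPartial, h.fderiv_eq]

theorem IsIsothermal.divergence_eq_zero (he : IsIsothermal S o x e) {W : Set M} (hW : IsOpen W)
    (hF : ∀ q ∈ W, Nonempty (AdaptedFrame S o x q)) {f β k : M → ℝ}
    (hf : ContMDiffOn (𝓡 2) 𝓘(ℝ, ℝ) ∞ f W) (hβ : ContMDiffOn (𝓡 2) 𝓘(ℝ, ℝ) ∞ β W)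
    (hk : ContMDiffOn (𝓡 2) 𝓘(ℝ, ℝ) ∞ k W)
    (h : ∀ q ∈ W, ∀ w, mvfderiv (𝓡 2) β q w = k q * mvfderiv (𝓡 2) f q (o.rot q w))
    (hq : q ∈ W ∩ e.source) :
    chartPartial e 0 f q * chartPartial e 0 k q + chartPartial e 1 f q * chartPartial e 1 k q
      + (chartPartial e 0 (chartPartial e 0 f) q
        + chartPartial e 1 (chartPartial e 1 f) q) * k q = 0 := by
  have hconj : ∀ z ∈ e.target ∩ e.symm ⁻¹' W,
      chartPartial e 0 β (e.symm z) = k (e.symm z) * chartPartial e 1 f (e.symm z) ∧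
      chartPartial e 1 β (e.symm z) = -(k (e.symm z) * chartPartial e 0 f (e.symm z)) := by
    intro z hz
    have hn := hW.mem_nhds hz.2
    obtain ⟨F⟩ := hF _ hz.2
    exact chartPartial_conjugate he (e.map_target hz.1) F
      ((hf.contMDiffAt hn).mdifferentiableAt (by simp))
      ((hβ.contMDiffAt hn).mdifferentiableAt (by simp)) (h _ hz.2)
  have key := divergence_eq_zero_of_conjugate (e.isOpen_inter_preimage_symm hW)
    (contDiffOn_comp_chart_symm he.1 hf) (contDiffOn_comp_chart_symm he.1 hβ)
    (contDiffOn_comp_chart_symm he.1 hk) (EuclideanSpace.single 0 1) (EuclideanSpace.single 1 1)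
    (fun z hz ↦ by simpa only [chartPartial, Function.comp_apply, e.right_inv hz.1] using (hconj z hz).1)
    (fun z hz ↦ by simpa only [chartPartial, Function.comp_apply, e.right_inv hz.1] using (hconj z hz).2)
    (z := e q) ⟨e.map_source hq.2, by simpa [e.left_inv hq.2] using hq.1⟩
  rw [chartPartial_chartPartial hq.2, chartPartial_chartPartial hq.2]
  simpa only [chartPartial, Function.comp_apply, e.left_inv hq.2] using key

end Isothermal

/-- Otherwise d(cos α) vanishes everywhere: where it did not, sin α would be nonzero and dα a
nonzero multiple of it. Then cos α, smooth on a connected surface, is constant. -/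
theorem exists_mvfderiv_kaehlerAngle_ne_zero [ConnectedSpace M] (S : ComplexSpaceForm N ρ)
    (o : SurfaceOrientation M) (hx : IsIsometricImmersion x)
    (h : ¬ ∃ c : ℝ, ∀ p : M, kaehlerAngle S o x p = c) :
    ∃ p : M, mvfderiv (𝓡 2) (kaehlerAngle S o x) p ≠ 0 := by
  by_contra! h0
  apply h
  obtain ⟨p₀⟩ := (inferInstance : Nonempty M)
  refine ⟨kaehlerAngle S o x p₀, fun p ↦ ?_⟩
  refine congrArg Real.arccos (eq_of_mvfderiv_eq_zero (f := kaehlerCos S o x)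
    ((contMDiff_kaehlerCos S o hx).mdifferentiable (by simp)) (fun q ↦ ?_) p p₀)
  by_contra hq
  have hs := sin_kaehlerAngle_ne_zero_of_mvfderiv_kaehlerCos S o hx hq
  apply hq
  ext v
  have hv := mvfderiv_kaehlerAngle S o hx hs v
  rw [h0 q] at hv
  exact (mul_eq_zero.1 hv.symm).resolve_left (neg_ne_zero.2 (inv_ne_zero hs))

theorem isOpen_sin_kaehlerAngle_ne_zero (S : ComplexSpaceForm N ρ)
    (o : SurfaceOrientation M) (hx : IsIsometricImmersion x) :
    IsOpen {q : M | Real.sin (kaehlerAngle S o x q) ≠ 0} := by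
  have hc := (contMDiff_kaehlerCos S o hx).continuous
  exact isOpen_ne.preimage (Real.continuous_sin.comp (Real.continuous_arccos.comp hc))

end

end KaehlerPMC

end

/-! ### Proof of the theorem. -/

theorem lemma2p1
    {M : Type*} [TopologicalSpace M] [ChartedSpace KaehlerPMC.E2 M] [IsManifold (𝓡 2) ∞ M]
    [RiemannianBundle (fun p : M ↦ TangentSpace (𝓡 2) p)]
    [IsContMDiffRiemannianBundle (𝓡 2) ∞ KaehlerPMC.E2 (fun p : M ↦ TangentSpace (𝓡 2) p)]
    [ConnectedSpace M]
    {N : Type*} [TopologicalSpace N] [ChartedSpace KaehlerPMC.E4 N] [IsManifold (𝓡 4) ∞ N]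
    [RiemannianBundle (fun y : N ↦ TangentSpace (𝓡 4) y)]
    [IsContMDiffRiemannianBundle (𝓡 4) ∞ KaehlerPMC.E4 (fun y : N ↦ TangentSpace (𝓡 4) y)]
    {ρ : ℝ} (S : KaehlerPMC.ComplexSpaceForm N ρ) (o : KaehlerPMC.SurfaceOrientation M)
    (x : M → N) (hx : KaehlerPMC.IsIsometricImmersion x)
    (hH : ∀ p : M, KaehlerPMC.meanCurvature S x p ≠ 0)
    (hpar : KaehlerPMC.HasParallelMeanCurvature S x)
    (α : M → ℝ) (hα : α = KaehlerPMC.kaehlerAngle S o x)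
    (hnonconst : ¬ ∃ c : ℝ, ∀ p : M, α p = c) :
    (∃ p : M, mvfderiv (𝓡 2) α p ≠ 0) ∧
    ∀ p : M, mvfderiv (𝓡 2) α p ≠ 0 →
      ∃ (χ : OpenPartialHomeomorph M KaehlerPMC.E2) (β k : M → ℝ),
        -- `(α, β)` is a smooth coordinate system on the neighbourhood `χ.source` of `p`
        χ ∈ IsManifold.maximalAtlas (𝓡 2) ∞ M ∧ p ∈ χ.source ∧
        (∀ q ∈ χ.source, χ q = !₂[α q, β q]) ∧
        ContMDiffOn (𝓡 2) 𝓘(ℝ, ℝ) ∞ k χ.source ∧ (∀ q ∈ χ.source, k q ≠ 0) ∧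
        -- the formula for `φ`
        (∀ q ∈ χ.source,
          Nonempty (KaehlerPMC.AdaptedFrame S o x q) ∧
          ∀ F : KaehlerPMC.AdaptedFrame S o x q,
            F.a + (KaehlerPMC.halfMean S x q : ℂ) ≠ 0 ∧
            ∀ w : TangentSpace (𝓡 2) q,
              F.phi w = ((k q : ℂ) * (mvfderiv (𝓡 2) α q w : ℂ)
                  - Complex.I * (mvfderiv (𝓡 2) β q w : ℂ))
                / (2 * (k q : ℂ) * (F.a + (KaehlerPMC.halfMean S x q : ℂ)))) ∧
        -- the equations for `k` and `β` in isothermal coordinates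
        (∀ e : OpenPartialHomeomorph M KaehlerPMC.E2, KaehlerPMC.IsIsothermal S o x e →
          ∀ q ∈ χ.source ∩ e.source,
            KaehlerPMC.chartPartial e 0 α q * KaehlerPMC.chartPartial e 0 k q
              + KaehlerPMC.chartPartial e 1 α q * KaehlerPMC.chartPartial e 1 k q
              + (KaehlerPMC.chartPartial e 0 (KaehlerPMC.chartPartial e 0 α) q
                + KaehlerPMC.chartPartial e 1 (KaehlerPMC.chartPartial e 1 α) q) * k q = 0 ∧
            KaehlerPMC.chartPartial e 0 β q = k q * KaehlerPMC.chartPartial e 1 α q ∧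
            KaehlerPMC.chartPartial e 1 β q = -(k q * KaehlerPMC.chartPartial e 0 α q)) := by
  subst hα
  refine ⟨KaehlerPMC.exists_mvfderiv_kaehlerAngle_ne_zero S o hx hnonconst, fun p hp ↦ ?_⟩
  -- On the open set sin α ≠ 0 the angle is smooth, and β, k come from an integrating factor: dβ = k
  -- dα ∘ rot.
  obtain ⟨V, hVU, hV, hpV, β, k, hβ, hk, h⟩ := KaehlerPMC.exists_mvfderiv_eq_smul_rot o
    (KaehlerPMC.isOpen_sin_kaehlerAngle_ne_zero S o hx)
    (KaehlerPMC.sin_kaehlerAngle_ne_zero_of_mvfderiv S o hx hp)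
    (fun q hq ↦ (KaehlerPMC.contMDiffAt_kaehlerAngle S o hx hq).contMDiffWithinAt) hp
  have hα : ContMDiffOn (𝓡 2) 𝓘(ℝ, ℝ) ∞ (KaehlerPMC.kaehlerAngle S o x) V := fun q hq ↦
    (KaehlerPMC.contMDiffAt_kaehlerAngle S o hx (hVU hq)).contMDiffWithinAt
  obtain ⟨χ, hχ, hpχ, hχV, hχeq⟩ := KaehlerPMC.exists_chart_of_injective hV hpV hα hβ
    (fun q hq w h1 h2 ↦ KaehlerPMC.eq_zero_of_mvfderiv_rot o (h q hq).1 h1 (by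
      rw [(h q hq).2.2 w] at h2
      exact (mul_eq_zero.1 h2).resolve_left (h q hq).2.1))
  have hF : ∀ q ∈ χ.source, Nonempty (KaehlerPMC.AdaptedFrame S o x q) := fun q hq ↦
    KaehlerPMC.nonempty_adaptedFrame S o hx (hVU (hχV hq)) (hH q)
  refine ⟨χ, β, k, hχ, hpχ, hχeq, hk.mono hχV, fun q hq ↦ (h q (hχV hq)).2.1,
    fun q hq ↦ ⟨hF q hq, fun F ↦ ?_⟩, fun e he q hq ↦ ⟨?_, ?_⟩⟩
  · obtain ⟨hα0, hk0, hβk⟩ := h q (hχV hq)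
    have hab := F.a_add_halfMean_ne_zero S o hx hα0
    have hkC : (k q : ℂ) ≠ 0 := Complex.ofReal_ne_zero.2 hk0
    refine ⟨hab, fun w ↦ ?_⟩
    -- Clearing the denominator leaves k times the identity 2(a + b) φ = dα - i dα ∘ rot.
    rw [eq_div_iff (mul_ne_zero (mul_ne_zero two_ne_zero hkC) hab), hβk w]
    push_cast
    linear_combination (k q : ℂ) * F.two_mul_phi S o hx (hVU (hχV hq)) w
  · exact he.divergence_eq_zero χ.open_source hF (hα.mono hχV) (hβ.mono hχV) (hk.mono hχV)
      (fun q hq ↦ (h q (hχV hq)).2.2) hq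
  · obtain ⟨F⟩ := hF q hq.1
    have hn := hV.mem_nhds (hχV hq.1)
    exact KaehlerPMC.chartPartial_conjugate he hq.2 F
      ((hα.contMDiffAt hn).mdifferentiableAt (by simp))
      ((hβ.contMDiffAt hn).mdifferentiableAt (by simp)) (h q (hχV hq.1)).2.2
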